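/- Let $\mathcal K$ be a field, $\Gamma\le\mathbb R$ an additive subgroup, and let $\Lambda$ be the Novikov field of formal sums $\sum_{g\in\Gamma}a_gT^g$ ($a_g\in\mathcal K$) with, for every $c\in\mathbb R$, only finitely many $g<c$ such that $a_g\ne 0$; put $\nu(\sum a_gT^g)=\min\{g\mid a_g\neq 0\}$ and $\nu(0)=\infty$. A non-Archimedean normed vector space is a $\Lambda$-vector space $V$ with $\ell:V\to\mathbb R\cup\{-\infty\}$ such that $\ell(x)=-\infty$ iff $x=0$, $\ell(\lambda x)=\ell(x)-\nu(\lambda)$ and $\ell(x+y)\le\max\{\ell(x),\ell(y)\}$. A finite ordered collection $(w_1,\dots,w_r)$ in $V$ is orthogonal if $\ell(\sum_i\lambda_iw_i)=\max_i\ell(\lambda_iw_i)$ for all $\lambda_i\in\Lambda$, and $(V,\ell)$ is orthogonalizable if $V$ is finite-dimensional with an orthogonal basis. A Floer-type complex $(C_*,\partial,\ell)$ over $\Lambda$ is a $\mathbb Z$-graded chain complex of $\Lambda$-vector spaces with a function $\ell$ on each $C_k$ making $C_k$ orthogonalizable, such that $\ell(\partial x)\le\ell(x)$ for all $x\in C_k$,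 $k\in\mathbb Z$. A singular value decomposition of a linear map $A:V\to W$ of rank $r$ between orthogonalizable spaces consists of orthogonal ordered bases $(y_1,\dots,y_n)$ of $V$ and $(x_1,\dots,x_m)$ of $W$ such that $(y_{r+1},\dots,y_n)$ is a basis of $\ker A$, $(x_1,\dots,x_r)$ is a basis of $\operatorname{Im}A$, $Ay_i=x_i$ for $i\le r$, and $\ell(y_1)-\ell(x_1)\ge\dots\ge\ell(y_r)-\ell(x_r)$. The degree-$k$ verbose barcode of $(C_*,\partial,\ell)$ is the multiset of elements of $(\mathbb R/\Gamma)\times[0,\infty]$ consisting of $([\ell(x_i)],\ell(y_i)-\ell(x_i))$ for $1\le i\le r$ and $([\ell(x_i)],\infty)$ for $r<i\le m$, for a singular value decomposition of $\partial_{k+1}:C_{k+1}\to\ker\partial_k$. The degree-$k$ concise barcode is the submultiset of those elements whose second coordinate is positive. A map preserves filtration if it does not increase $\ell$. Two Floer-type complexes $C_*$, $D_*$ are filtered chain homotopy equivalent if there are filtration-preserving chain maps $\Phi:C_*\to D_*$ and $\Psi:D_*\to C_*$ such that $\Psi\Phi$ and $\Phi\Psi$ are chain homotopic to the respective identities through filtration-preserving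 chain homotopies $C_*\to C_{*+1}$ and $D_*\to D_{*+1}$. **Theorem B.** The verbose, hence also the concise, barcodes of a Floer-type complex are well defined: in every degree a singular value decomposition as above exists, and the resulting multiset does not depend on its choice. Two Floer-type complexes $(C_*,\partial_C,\ell_C)$ and $(D_*,\partial_D,\ell_D)$ over $\Lambda$ are filtered chain homotopy equivalent if and only if their degree-$k$ concise barcodes are equal for every $k\in\mathbb Z$. -/

import Mathlib

open scoped ENNReal
open CategoryTheory

universe u v

namespace FloerType

section Novikov

variable (K : Type u) [Field K] (Γ : AddSubgroup ℝ)

/-- `f` has only finitely many nonzero coefficients below any given real number. -/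
def LocFin {K : Type u} [Field K] {Γ : AddSubgroup ℝ} (f : HahnSeries Γ K) : Prop :=
  ∀ c : ℝ, {g : Γ | f.coeff g ≠ 0 ∧ (g : ℝ) < c}.Finite

variable {K Γ}

theorem LocFin.mul {f h : HahnSeries Γ K} (hf : LocFin f) (hh : LocFin h) :
    LocFin (f * h) := by
  intro c
  refine ((Set.Finite.add (hf (c - (h.order : ℝ))) (hh (c - (f.order : ℝ))))).subset ?_
  rintro g ⟨hg, hgc⟩
  have hg' : g ∈ (f * h).support := hg
  obtain ⟨a, ha, b, hb, rfl⟩ := Set.mem_add.1 (HahnSeries.support_mul_subset hg')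
  have h1 : f.order ≤ a := HahnSeries.order_le_of_coeff_ne_zero ha
  have h2 : h.order ≤ b := HahnSeries.order_le_of_coeff_ne_zero hb
  have h1' : (f.order : ℝ) ≤ a := h1
  have h2' : (h.order : ℝ) ≤ b := h2
  push_cast at hgc
  exact Set.add_mem_add ⟨ha, by linarith⟩ ⟨hb, by linarith⟩

theorem LocFin.inv {f : HahnSeries Γ K} (hf : LocFin f) : LocFin f⁻¹ := by
  rcases eq_or_ne f 0 with rfl | hf0
  · simpa using hf
  classical
  -- the exponents of `f` above its lowest one, normalised to be positive
  set o : Γ := f.order with ho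
  set P : Set Γ := {p | f.coeff (o + p) ≠ 0 ∧ 0 < p} with hP
  have hPfin : ∀ c : ℝ, {p : Γ | p ∈ P ∧ (p : ℝ) < c}.Finite := by
    intro c
    refine ((hf (o + c)).image (fun g => g - o)).subset ?_
    rintro p ⟨⟨hp, -⟩, hpc⟩
    exact ⟨o + p, ⟨hp, by push_cast; linarith⟩, by simp⟩
  obtain ⟨ε, hε, hPε⟩ : ∃ ε : ℝ, 0 < ε ∧ ∀ p ∈ P, ε ≤ (p : ℝ) := by
    rcases (hPfin 1).toFinset.eq_empty_or_nonempty with h | h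
    · refine ⟨1, one_pos, fun p hp => ?_⟩
      by_contra hlt
      have : p ∈ (hPfin 1).toFinset := by simpa using ⟨hp, not_le.1 hlt⟩
      rw [h] at this
      exact absurd this (Finset.notMem_empty _)
    · obtain ⟨q, hq, hmin⟩ := Finset.exists_min_image _ (fun p : Γ => (p : ℝ)) h
      have hq' : q ∈ P ∧ (q : ℝ) < 1 := by simpa using hq
      refine ⟨q, hq'.1.2, fun p hp => ?_⟩
      by_cases hp1 : (p : ℝ) < 1
      · exact hmin p (by simpa using ⟨hp, hp1⟩)
      · linarith [hq'.2, not_lt.1 hp1]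
  have hrec : ∀ g : Γ, f⁻¹.coeff g ≠ 0 → g = -o ∨ ∃ p ∈ P, f⁻¹.coeff (g - p) ≠ 0 := by
    intro g hg
    by_contra! hcon
    obtain ⟨hne, hall⟩ := hcon
    have h1 : (f * f⁻¹).coeff (o + g) = f.coeff o * f⁻¹.coeff g := by
      rw [HahnSeries.coeff_mul]
      rw [Finset.sum_eq_single (o, g)]
      · rintro ⟨a, b⟩ hab habne
        rw [Finset.mem_antidiagonal] at hab
        obtain ⟨ha, hb, hs⟩ := hab
        simp only at ha hb hs ⊢
        have hoa : o ≤ a := HahnSeries.order_le_of_coeff_ne_zero ha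
        have hb' : b = g - (a - o) := by
          rw [eq_sub_iff_add_eq, ← add_sub_assoc, add_comm b a, hs]; simp
        rcases hoa.eq_or_lt with h | h
        · exact absurd (by subst h; simpa using hb') (fun e : b = g => habne (by rw [e, ← h]))
        · rw [hb', hall (a - o) ⟨by simpa using ha, by simpa using h⟩, mul_zero]
      · intro hno
        rw [Finset.mem_antidiagonal] at hno
        by_contra hcc
        exact hno ⟨left_ne_zero_of_mul hcc, right_ne_zero_of_mul hcc, rfl⟩
    rw [mul_inv_cancel₀ hf0, HahnSeries.coeff_one, if_neg] at h1
    · exact mul_ne_zero (fun e => hf0 (HahnSeries.coeff_order_eq_zero.1 e)) hg h1.symm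
    · intro e
      exact hne (eq_neg_of_add_eq_zero_right e)
  have hge : ∀ g : Γ, f⁻¹.coeff g ≠ 0 → -o ≤ g := by
    intro g hg
    have hi : f⁻¹ ≠ 0 := inv_ne_zero hf0
    have h1 := HahnSeries.order_mul hf0 hi
    rw [mul_inv_cancel₀ hf0, HahnSeries.order_one] at h1
    rw [← eq_neg_of_add_eq_zero_right h1.symm]
    exact HahnSeries.order_le_of_coeff_ne_zero hg
  have key : ∀ n : ℕ, {g : Γ | f⁻¹.coeff g ≠ 0 ∧ (g : ℝ) < -o + n * ε}.Finite := by
    intro n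
    induction n with
    | zero =>
      refine Set.finite_empty.subset ?_
      rintro g ⟨hg, hlt⟩
      have : ((-o : Γ) : ℝ) ≤ g := hge g hg
      push_cast at this hlt
      linarith
    | succ n ih =>
      refine ((Set.finite_singleton (-o)).union (ih.add (hPfin ((n + 1) * ε)))).subset ?_
      rintro g ⟨hg, hlt⟩
      push_cast at hlt
      rcases hrec g hg with h | ⟨p, hp, hgp⟩
      · exact Or.inl h
      · right
        have h1 := hPε p hp
        have h2 : ((-o : Γ) : ℝ) ≤ (g - p : Γ) := hge _ hgp
        push_cast at h2
        exact ⟨g - p, ⟨hgp, by push_cast; linarith⟩, p, ⟨hp, by linarith⟩, by simp⟩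
  intro c
  obtain ⟨n, hn⟩ := exists_nat_gt ((c + o) / ε)
  rw [div_lt_iff₀ hε] at hn
  refine (key n).subset ?_
  rintro g ⟨hg, hlt⟩
  exact ⟨hg, by linarith⟩

variable (K Γ)

/-- The formal sums `∑ a_g T^g`, `g ∈ Γ`, with finitely many nonzero terms below any real
number. (Such a sum automatically has well-ordered support, i.e. it is a Hahn series.) -/
def novikov : Subfield (HahnSeries Γ K) where
  carrier := {f | LocFin f}
  mul_mem' := LocFin.mul
  one_mem' := by
    intro c
    refine (Set.finite_singleton (0 : Γ)).subset ?_
    rintro g ⟨hg, -⟩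
    by_contra h
    exact hg (by rw [HahnSeries.coeff_one]; exact if_neg h)
  add_mem' := by
    intro f h hf hh c
    refine ((hf c).union (hh c)).subset ?_
    rintro g ⟨hg, hc⟩
    by_cases h0 : f.coeff g = 0
    · exact Or.inr ⟨fun e => hg (by simp [h0, e]), hc⟩
    · exact Or.inl ⟨h0, hc⟩
  zero_mem' := by intro c; simp
  neg_mem' := by
    intro f hf c
    simpa using hf c
  inv_mem' := fun _ hf => LocFin.inv hf

/-- The Novikov field `Λ^{K,Γ}`. -/
abbrev NovikovField : Type u := novikov K Γ

variable {K Γ}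

open Classical in
/-- The valuation on the Novikov field: the least exponent occurring, and `∞` for `0`. -/
noncomputable def val (a : NovikovField K Γ) : EReal :=
  if a = 0 then ⊤ else (((a : HahnSeries Γ K).order : ℝ) : EReal)

end Novikov

section Normed

variable {K : Type u} [Field K] {Γ : AddSubgroup ℝ}
  {V : Type v} [AddCommGroup V] [Module (NovikovField K Γ) V]
  {W : Type v} [AddCommGroup W] [Module (NovikovField K Γ) W]

/-- `ℓ : V → ℝ ∪ {-∞}` is a filtration function making `V` a non-Archimedean normed
vector space over the Novikov field. -/
structure IsFiltration (ℓ : V → EReal) : Prop where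
  ne_top : ∀ x, ℓ x ≠ ⊤
  eq_bot_iff : ∀ x, ℓ x = ⊥ ↔ x = 0
  smul : ∀ (a : NovikovField K Γ) (x : V), ℓ (a • x) = ℓ x - val a
  add_le : ∀ x y, ℓ (x + y) ≤ max (ℓ x) (ℓ y)

/-- Orthogonality of a finite ordered collection. -/
def IsOrthogonal (ℓ : V → EReal) {n : ℕ} (w : Fin n → V) : Prop :=
  ∀ a : Fin n → NovikovField K Γ, ℓ (∑ i, a i • w i) = ⨆ i, ℓ (a i • w i)

/-- `(V, ℓ)` is an orthogonalizable space: a finite-dimensional non-Archimedean normed vector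
space that has an orthogonal basis. -/
structure IsOrthogonalizable (ℓ : V → EReal) : Prop where
  filtration : IsFiltration (K := K) (Γ := Γ) ℓ
  exists_basis : ∃ (n : ℕ) (b : Module.Basis (Fin n) (NovikovField K Γ) V),
    IsOrthogonal (K := K) (Γ := Γ) ℓ b

/-- A (non-Archimedean) singular value decomposition of a linear map `A`: orthogonal ordered
bases `y` of the source and `x` of the target adapted to the kernel and the image of `A`.
(Indices start at `0`, so `y_1, …, y_r` are the `y i` with `i < r`.) -/
structure SVD (ℓV : V → EReal) (ℓW : W → EReal) (A : V →ₗ[NovikovField K Γ] W) where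
  n : ℕ
  m : ℕ
  r : ℕ
  r_eq : r = Module.finrank (NovikovField K Γ) (LinearMap.range A)
  r_le_n : r ≤ n
  r_le_m : r ≤ m
  y : Module.Basis (Fin n) (NovikovField K Γ) V
  x : Module.Basis (Fin m) (NovikovField K Γ) W
  y_orthogonal : IsOrthogonal (K := K) (Γ := Γ) ℓV y
  x_orthogonal : IsOrthogonal (K := K) (Γ := Γ) ℓW x
  span_ker : Submodule.span (NovikovField K Γ) (y '' {i | r ≤ (i : ℕ)}) = LinearMap.ker A
  span_range : Submodule.span (NovikovField K Γ) (x '' {i | (i : ℕ) < r}) = LinearMap.range A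
  map_y : ∀ i : Fin r, A (y (Fin.castLE r_le_n i)) = x (Fin.castLE r_le_m i)
  sorted : ∀ i j : Fin r, i ≤ j →
    ℓV (y (Fin.castLE r_le_n j)) - ℓW (x (Fin.castLE r_le_m j)) ≤
      ℓV (y (Fin.castLE r_le_n i)) - ℓW (x (Fin.castLE r_le_m i))

/-- The multiset of bars `([ℓ(x_i)], ℓ(y_i) - ℓ(x_i))` for `i ≤ r` and `([ℓ(x_i)], ∞)` for `i > r`
read off from a singular value decomposition. -/
noncomputable def SVD.bars {ℓV : V → EReal} {ℓW : W → EReal} {A : V →ₗ[NovikovField K Γ] W}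
    (s : SVD ℓV ℓW A) : Multiset ((ℝ ⧸ Γ) × ℝ≥0∞) :=
  (Finset.univ : Finset (Fin s.m)).val.map fun i =>
    (((ℓW (s.x i)).toReal : ℝ ⧸ Γ),
      if h : (i : ℕ) < s.r then
        (ℓV (s.y ⟨i, h.trans_le s.r_le_n⟩) - ℓW (s.x i)).toENNReal
      else ∞)

end Normed

/-- A Floer-type complex over the Novikov field `Λ^{K,Γ}`. -/
structure FloerComplex (K : Type u) [Field K] (Γ : AddSubgroup ℝ) where
  cx : ChainComplex (ModuleCat.{v} (NovikovField K Γ)) ℤ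
  ℓ : ∀ k : ℤ, cx.X k → EReal
  orthogonalizable : ∀ k, IsOrthogonalizable (K := K) (Γ := Γ) (ℓ k)
  boundary_le : ∀ (k : ℤ) (x : cx.X k), ℓ (k - 1) (cx.d k (k - 1) x) ≤ ℓ k x

variable {K : Type u} [Field K] {Γ : AddSubgroup ℝ}

namespace FloerComplex

/-- The space `Z_k` of degree-`k` cycles. -/
noncomputable abbrev cycles (C : FloerComplex.{u, v} K Γ) (k : ℤ) :
    Submodule (NovikovField K Γ) (C.cx.X k) :=
  LinearMap.ker (C.cx.d k (k - 1)).hom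

/-- The boundary map `∂_{k+1} : C_{k+1} → Z_k`. -/
noncomputable def boundary (C : FloerComplex.{u, v} K Γ) (k : ℤ) :
    C.cx.X (k + 1) →ₗ[NovikovField K Γ] C.cycles k :=
  (C.cx.d (k + 1) k).hom.codRestrict (C.cycles k) fun x => by
    have h := C.cx.d_comp_d (k + 1) k (k - 1)
    exact congrArg (fun f => f.hom x) h

/-- Singular value decompositions of `∂_{k+1} : C_{k+1} → Z_k`. -/
abbrev BoundarySVD (C : FloerComplex.{u, v} K Γ) (k : ℤ) :=
  SVD (C.ℓ (k + 1)) (fun z : C.cycles k => C.ℓ k z) (C.boundary k)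

open Classical in
/-- The degree-`k` verbose barcode, read off from a chosen singular value decomposition. -/
noncomputable def verboseBarcode (C : FloerComplex.{u, v} K Γ) (k : ℤ) :
    Multiset ((ℝ ⧸ Γ) × ℝ≥0∞) :=
  if h : Nonempty (C.BoundarySVD k) then (Classical.choice h).bars else 0

open Classical in
/-- The degree-`k` concise barcode: the bars of positive length. -/
noncomputable def conciseBarcode (C : FloerComplex.{u, v} K Γ) (k : ℤ) :
    Multiset ((ℝ ⧸ Γ) × ℝ≥0∞) :=
  (C.verboseBarcode k).filter fun b => 0 < b.2

/-- The verbose barcodes of `C` are well defined: in each degree a singular value decomposition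
exists, and all of them give the same multiset of bars. -/
def BarcodesWellDefined (C : FloerComplex.{u, v} K Γ) : Prop :=
  ∀ k : ℤ, Nonempty (C.BoundarySVD k) ∧ ∀ s : C.BoundarySVD k, s.bars = C.verboseBarcode k

/-- A chain map preserves filtration if it does not increase filtration levels. -/
def PreservesFiltration (C D : FloerComplex.{u, v} K Γ) (Φ : C.cx ⟶ D.cx) : Prop :=
  ∀ (k : ℤ) (x : C.cx.X k), D.ℓ k (Φ.f k x) ≤ C.ℓ k x

/-- Two chain maps are filtered chain homotopic. -/
def FilteredHomotopic (C D : FloerComplex.{u, v} K Γ) (Φ Ψ : C.cx ⟶ D.cx) : Prop :=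
  PreservesFiltration C D Φ ∧ PreservesFiltration C D Ψ ∧
    ∃ h : Homotopy Φ Ψ, ∀ (k : ℤ) (x : C.cx.X k),
      D.ℓ (k + 1) (h.hom k (k + 1) x) ≤ C.ℓ k x

/-- Filtered (chain) homotopy equivalence of Floer-type complexes. -/
def FilteredHomotopyEquivalent (C D : FloerComplex.{u, v} K Γ) : Prop :=
  ∃ (Φ : C.cx ⟶ D.cx) (Ψ : D.cx ⟶ C.cx),
    PreservesFiltration C D Φ ∧ PreservesFiltration D C Ψ ∧
    FilteredHomotopic C C (Φ ≫ Ψ) (𝟙 C.cx) ∧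
    FilteredHomotopic D D (Ψ ≫ Φ) (𝟙 D.cx)

end FloerComplex

end FloerType

/-! Existence is Gaussian elimination with a filtered pivot rule. Among the unmatched source vectors
take the one whose image drops least in level; the leading term of that image is the pivot.
Minimality of the drop makes every multiple subtracted from another source vector small enough to
keep the family orthogonal, and the image may replace the target vector carrying its leading term
(`OrthFam.shear`, `OrthFam.replace`, `Matching.step`). Kernels are orthogonalizable as a
consequence, so the argument applies to the boundary map into the cycles.

Uniqueness and invariance are the same statement, `Comparison.count_le`. Fix a bar `([t], len)`,
rescale to level `t` the vectors `x_i` carrying it on both sides, and read off the coefficients at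
`T^0` of the coordinates of `Φ w`. This gives a `K`-linear map between spaces whose dimensions are
the two multiplicities, and it must be shown injective. If all these coefficients vanish on `v`,
then `Φ v = z + A' d` with `z` below level `t` and, for finite `len = σ`, `d` below level `t + σ`.
Applying `Ψ` gives `v = Ψ z + A e`, where `e` is again below `t + σ`: the homotopy term has level at
most `t`, which is harmless when `σ > 0`. As `y_i` lies exactly `σ` above `x_i`, the relevant
coordinates of `A e` lie below `t`; for `len = ∞` they vanish. So `v` lies below `t`, and
orthogonality kills its coefficients. The identity comparison, with zero homotopy, handles bars of
length zero too and gives well-definedness; a filtered homotopy equivalence gives equality of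
positive bars.

Conversely, equal concise barcodes yield maps `f`, `g` between cycles that exchange rescaled basis
vectors of matching bars and kill zero-length bars. The chains split as cycles plus the span of the
`y_i` with `i < r`, by a filtered projection, so `f` and `g` extend to chain maps. The defect `1 - g
f` lives on zero-length bars, where lifting `x_i` to `y_i` costs no level, and this lift is the
homotopy. -/

namespace FloerType

/-! ### Valuations, monomials and coefficients at `T^0` in the Novikov field. -/

section Valuation

variable {K : Type u} [Field K] {Γ : AddSubgroup ℝ}

theorem val_zero : val (0 : NovikovField K Γ) = ⊤ := by simp [val]

theorem val_of_ne_zero {a : NovikovField K Γ} (h : a ≠ 0) :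
    val a = (((a : HahnSeries Γ K).order : ℝ) : EReal) := by simp [val, h]

theorem exists_val_eq {a : NovikovField K Γ} (h : a ≠ 0) : ∃ g : Γ, val a = ((g : ℝ) : EReal) :=
  ⟨_, val_of_ne_zero h⟩

theorem locFin_single (g : Γ) (k : K) : LocFin (HahnSeries.single g k) := by
  intro c
  refine (Set.finite_singleton g).subset ?_
  rintro x ⟨hx, -⟩
  by_contra h
  exact hx (HahnSeries.coeff_single_of_ne h)

/-- The monomial `T ^ g`. -/
noncomputable def mono (K : Type u) [Field K] {Γ : AddSubgroup ℝ} (g : Γ) : NovikovField K Γ :=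
  ⟨HahnSeries.single g 1, locFin_single g 1⟩

theorem mono_ne_zero (g : Γ) : mono K g ≠ 0 := by
  intro h
  have := congrArg Subtype.val h
  exact HahnSeries.single_ne_zero one_ne_zero this

theorem val_mono (g : Γ) : val (mono K g) = ((g : ℝ) : EReal) := by
  rw [val_of_ne_zero (mono_ne_zero g)]
  simp [mono, HahnSeries.order_single]

/-- The inclusion of the constants. -/
noncomputable def const (K : Type u) [Field K] (Γ : AddSubgroup ℝ) : K →+* NovikovField K Γ :=
  (HahnSeries.C : K →+* HahnSeries Γ K).codRestrict (novikov K Γ) fun k => locFin_single 0 k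

theorem val_const {k : K} (h : k ≠ 0) : val (const K Γ k) = 0 := by
  rw [val_of_ne_zero ((map_ne_zero _).2 h)]
  have : ((const K Γ k : NovikovField K Γ) : HahnSeries Γ K) = HahnSeries.single 0 k := rfl
  rw [this, HahnSeries.order_single h]
  simp

/-- The coefficient at `T ^ 0`. -/
noncomputable def coeffZero (a : NovikovField K Γ) : K := (a : HahnSeries Γ K).coeff 0

theorem coeffZero_add (a b : NovikovField K Γ) :
    coeffZero (a + b) = coeffZero a + coeffZero b := by
  simp [coeffZero]

theorem coeffZero_const_mul (k : K) (a : NovikovField K Γ) :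
    coeffZero (const K Γ k * a) = k * coeffZero a := by
  have : ((const K Γ k * a : NovikovField K Γ) : HahnSeries Γ K)
      = HahnSeries.single 0 k * (a : HahnSeries Γ K) := rfl
  rw [coeffZero, this, HahnSeries.coeff_single_mul, sub_zero, coeffZero]

theorem val_pos_of_coeffZero_eq_zero {a : NovikovField K Γ} (h0 : 0 ≤ val a)
    (h : coeffZero a = 0) : 0 < val a := by
  rcases eq_or_ne a 0 with rfl | ha
  · rw [val_zero]; exact EReal.zero_lt_top
  · refine lt_of_le_of_ne h0 fun he => ?_
    rw [val_of_ne_zero ha] at he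
    have h1 : (a : HahnSeries Γ K).order = 0 := by
      have : (0 : ℝ) = ((a : HahnSeries Γ K).order : ℝ) := by exact_mod_cast he
      exact Subtype.ext this.symm
    have h2 : (a : HahnSeries Γ K) ≠ 0 := fun e => ha (Subtype.ext e)
    apply h2
    rw [← HahnSeries.coeff_order_eq_zero, h1]
    exact h

end Valuation

/-! ### Orthogonal families and the moves that preserve orthogonality. -/

section Filtration

variable {K : Type u} [Field K] {Γ : AddSubgroup ℝ}
  {V : Type v} [AddCommGroup V] [Module (NovikovField K Γ) V]
  {W : Type v} [AddCommGroup W] [Module (NovikovField K Γ) W]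
  {ℓ : V → EReal} {ℓW : W → EReal}

namespace IsFiltration

variable (hℓ : IsFiltration (K := K) (Γ := Γ) ℓ)
include hℓ

theorem zero : ℓ 0 = ⊥ := (hℓ.eq_bot_iff 0).2 rfl

theorem coe_toReal {x : V} (hx : x ≠ 0) : ((ℓ x).toReal : EReal) = ℓ x :=
  EReal.coe_toReal (hℓ.ne_top x) fun h => hx ((hℓ.eq_bot_iff x).1 h)

theorem neg (x : V) : ℓ (-x) = ℓ x := by
  have h : ∀ x, ℓ (-x) ≤ ℓ x := by
    intro x
    have h1 : val (-1 : NovikovField K Γ) = 0 := by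
      rw [val_of_ne_zero (neg_ne_zero.2 one_ne_zero)]
      simp
    have := hℓ.smul (-1) x
    rw [h1, neg_one_smul, sub_zero] at this
    exact this.le
  exact le_antisymm (h x) (by simpa using h (-x))

theorem sub_le (x y : V) : ℓ (x - y) ≤ max (ℓ x) (ℓ y) := by
  rw [sub_eq_add_neg, ← hℓ.neg y]
  exact hℓ.add_le _ _

theorem sum_le {ι : Type*} (s : Finset ι) (f : ι → V) {t : EReal} (h : ∀ i ∈ s, ℓ (f i) ≤ t) :
    ℓ (∑ i ∈ s, f i) ≤ t := by
  classical
  induction s using Finset.induction_on with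
  | empty => rw [Finset.sum_empty, hℓ.zero]; exact bot_le
  | insert a s ha ih =>
    rw [Finset.sum_insert ha]
    exact (hℓ.add_le _ _).trans (max_le (h a (by simp)) (ih fun i hi => h i (by simp [hi])))

theorem sum_lt {ι : Type*} (s : Finset ι) (f : ι → V) {t : EReal} (ht : ⊥ < t)
    (h : ∀ i ∈ s, ℓ (f i) < t) : ℓ (∑ i ∈ s, f i) < t := by
  classical
  induction s using Finset.induction_on with
  | empty => rw [Finset.sum_empty, hℓ.zero]; exact ht
  | insert a s ha ih =>
    rw [Finset.sum_insert ha]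
    exact (hℓ.add_le _ _).trans_lt (max_lt (h a (by simp)) (ih fun i hi => h i (by simp [hi])))

theorem smul_le_smul {ℓ' : W → EReal} (hℓ' : IsFiltration (K := K) (Γ := Γ) ℓ') {x : V} {y : W}
    (h : ℓ x ≤ ℓ' y) (a : NovikovField K Γ) : ℓ (a • x) ≤ ℓ' (a • y) := by
  rw [hℓ.smul, hℓ'.smul]
  exact EReal.sub_le_sub h le_rfl

theorem smul_eq_add {ℓ' : W → EReal} (hℓ' : IsFiltration (K := K) (Γ := Γ) ℓ') {x : V} {y : W}
    {σ : EReal} (h : ℓ x = ℓ' y + σ) (a : NovikovField K Γ) : ℓ (a • x) = ℓ' (a • y) + σ := by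
  rw [hℓ.smul, hℓ'.smul, h, sub_eq_add_neg, sub_eq_add_neg, add_right_comm]

theorem smul_eq_smul {ℓ' : W → EReal} (hℓ' : IsFiltration (K := K) (Γ := Γ) ℓ') {x : V} {y : W}
    (h : ℓ x = ℓ' y) (a : NovikovField K Γ) : ℓ (a • x) = ℓ' (a • y) := by
  rw [hℓ.smul, hℓ'.smul, h]

theorem subspace (Z : Submodule (NovikovField K Γ) V) :
    IsFiltration (K := K) (Γ := Γ) fun z : Z => ℓ z where
  ne_top x := hℓ.ne_top x
  eq_bot_iff x := by rw [hℓ.eq_bot_iff]; simp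
  smul a x := hℓ.smul a x
  add_le x y := hℓ.add_le x y

end IsFiltration

/-- Orthogonality of a finite family, in the form "every term is bounded by the sum". -/
def OrthFam (K : Type u) [Field K] (Γ : AddSubgroup ℝ) {V : Type v} [AddCommGroup V]
    [Module (NovikovField K Γ) V] (ℓ : V → EReal) {ι : Type*} [Fintype ι] (w : ι → V) : Prop :=
  ∀ (a : ι → NovikovField K Γ) (i : ι), ℓ (a i • w i) ≤ ℓ (∑ j, a j • w j)

theorem orthFam_iff (hℓ : IsFiltration (K := K) (Γ := Γ) ℓ) {n : ℕ} {w : Fin n → V} :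
    OrthFam K Γ ℓ w ↔ IsOrthogonal (K := K) (Γ := Γ) ℓ w := by
  constructor
  · intro h a
    refine le_antisymm (hℓ.sum_le _ _ fun i _ => ?_) (iSup_le fun i => h a i)
    exact le_iSup (fun i => ℓ (a i • w i)) i
  · intro h a i
    rw [h a]
    exact le_iSup (fun i => ℓ (a i • w i)) i

namespace OrthFam

variable {ι : Type*} [Fintype ι] {w : ι → V}

theorem linearIndependent (hℓ : IsFiltration (K := K) (Γ := Γ) ℓ) (h : OrthFam K Γ ℓ w)
    (h0 : ∀ i, w i ≠ 0) : LinearIndependent (NovikovField K Γ) w := by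
  rw [Fintype.linearIndependent_iff]
  intro a ha i
  have h1 := h a i
  rw [ha, hℓ.zero, le_bot_iff, hℓ.eq_bot_iff, smul_eq_zero] at h1
  exact h1.resolve_right (h0 i)

theorem comp_injective {κ : Type*} [Fintype κ] (h : OrthFam K Γ ℓ w)
    {f : κ → ι} (hf : Function.Injective f) : OrthFam K Γ ℓ (w ∘ f) := by
  classical
  intro a i
  have key : ∑ j, (Function.extend f a 0) j • w j = ∑ k, a k • w (f k) := by
    rw [← Finset.sum_subset (Finset.subset_univ (Finset.univ.image f)),
      Finset.sum_image (fun _ _ _ _ e => hf e)]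
    · exact Finset.sum_congr rfl fun k _ => by rw [hf.extend_apply]
    · intro x _ hx
      rw [Function.extend_apply' _ _ _ (by simpa using hx)]
      simp
  have := h (Function.extend f a 0) (f i)
  rw [key, hf.extend_apply] at this
  exact this

/-- Shearing along one member of an orthogonal family by small amounts. -/
theorem shear [DecidableEq ι] (hℓ : IsFiltration (K := K) (Γ := Γ) ℓ) (h : OrthFam K Γ ℓ w)
    (c : ι → NovikovField K Γ) (i₀ : ι) (hc0 : c i₀ = 0) (hc : ∀ i, ℓ (c i • w i₀) ≤ ℓ (w i)) :
    OrthFam K Γ ℓ (fun i => w i - c i • w i₀) := by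
  intro a
  have hterm : ∀ i, ℓ (a i • (w i - c i • w i₀)) ≤ ℓ (a i • w i) := by
    intro i
    refine hℓ.smul_le_smul hℓ ((hℓ.sub_le _ _).trans (max_le le_rfl (hc i))) _
  -- Coefficients of the sheared combination in the original family: only the one at `i₀` changes.
  set b : ι → NovikovField K Γ := fun i => if i = i₀ then a i₀ - ∑ j, a j * c j else a i with hb
  have hsum : ∑ j, a j • (w j - c j • w i₀) = ∑ j, b j • w j := by
    have h1 : ∀ j, b j • w j = a j • w j - if j = i₀ then (∑ j, a j * c j) • w i₀ else 0 := by
      intro j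
      by_cases hj : j = i₀
      · subst hj; simp [hb, sub_smul]
      · simp [hb, hj]
    simp_rw [h1, Finset.sum_sub_distrib, smul_sub, Finset.sum_sub_distrib, Finset.sum_smul,
      smul_smul]
    simp
  have hne : ∀ i, i ≠ i₀ → ℓ (a i • w i) ≤ ℓ (∑ j, a j • (w j - c j • w i₀)) := by
    intro i hi
    have := h b i
    rw [← hsum] at this
    simpa [hb, hi] using this
  have h0 : ℓ (a i₀ • w i₀) ≤ ℓ (∑ j, a j • (w j - c j • w i₀)) := by
    have h2 := h b i₀
    rw [← hsum] at h2
    -- The shears are added back. Each is at most `a j • w j`, already bounded by `hne`; the one at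
    -- `i₀` itself vanishes by `hc0`.
    have h3 : a i₀ • w i₀ = b i₀ • w i₀ + ∑ j, a j • c j • w i₀ := by
      simp [hb, sub_smul, Finset.sum_smul, smul_smul]
    rw [h3]
    refine (hℓ.add_le _ _).trans (max_le h2 (hℓ.sum_le _ _ fun j _ => ?_))
    by_cases hj : j = i₀
    · subst hj; rw [hc0]; simp [hℓ.zero]
    · exact (hℓ.smul_le_smul hℓ (hc j) _).trans (hne j hj)
  intro i
  refine (hterm i).trans ?_
  by_cases hi : i = i₀
  · subst hi; exact h0
  · exact hne i hi

/-- Replacing one member of an orthogonal family by a vector whose leading term is there. -/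
theorem replace [DecidableEq ι] (hℓ : IsFiltration (K := K) (Γ := Γ) ℓ) (h : OrthFam K Γ ℓ w)
    (a : ι → NovikovField K Γ) (i₀ : ι) (ha : ℓ (∑ j, a j • w j) ≤ ℓ (a i₀ • w i₀)) :
    OrthFam K Γ ℓ (Function.update w i₀ (∑ j, a j • w j)) := by
  intro b
  set v := ∑ j, a j • w j with hv
  set b' : ι → NovikovField K Γ := fun i => (if i = i₀ then 0 else b i) + b i₀ * a i with hb'
  have hsum : ∑ j, b j • Function.update w i₀ v j = ∑ j, b' j • w j := by
    have h1 : ∀ j, b j • Function.update w i₀ v j =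
        (if j = i₀ then 0 else b j) • w j + if j = i₀ then b i₀ • v else 0 := by
      intro j
      by_cases hj : j = i₀
      · subst hj; simp
      · simp [hj]
    simp_rw [h1, hb', add_smul, Finset.sum_add_distrib, mul_smul, ← Finset.smul_sum, ← hv]
    simp
  rw [hsum]
  -- The coefficient of the sum at `i₀` is exactly `b i₀ * a i₀`, and `v` is no higher than its term
  -- at `i₀`.
  have h0 : ℓ (b i₀ • v) ≤ ℓ (∑ j, b' j • w j) := by
    refine (hℓ.smul_le_smul hℓ ha (b i₀)).trans ?_
    have := h b' i₀
    simpa [hb', mul_smul] using this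
  intro i
  by_cases hi : i = i₀
  · subst hi; simpa using h0
  · have h2 : b i • w i = b' i • w i - b i₀ • a i • w i := by
      simp [hb', hi, add_smul, mul_smul]
    rw [Function.update_of_ne hi, h2]
    refine (hℓ.sub_le _ _).trans (max_le (h b' i) (le_trans ?_ h0))
    exact hℓ.smul_le_smul hℓ (h a i) _

end OrthFam

end Filtration

/-! ### Existence of singular value decompositions by filtered elimination. -/

section Existence

variable {K : Type u} [Field K] {Γ : AddSubgroup ℝ}
  {V : Type v} [AddCommGroup V] [Module (NovikovField K Γ) V]
  {W : Type v} [AddCommGroup W] [Module (NovikovField K Γ) W]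
  {ℓV : V → EReal} {ℓW : W → EReal}

/-- Pairs of orthogonal families, partially matched by a linear map. -/
structure Matching (ℓV : V → EReal) (ℓW : W → EReal) (A : V →ₗ[NovikovField K Γ] W)
    (ι κ : Type) [Fintype ι] [Fintype κ] where
  y : ι → V
  x : κ → W
  P : Finset ι
  m : ι → κ
  orth_y : OrthFam K Γ ℓV y
  orth_x : OrthFam K Γ ℓW x
  y_ne : ∀ i, y i ≠ 0
  x_ne : ∀ k, x k ≠ 0
  inj : Set.InjOn m P
  map_y : ∀ p ∈ P, A (y p) = x (m p)
  a : ι → κ → NovikovField K Γ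
  map_rest : ∀ i, i ∉ P → A (y i) = ∑ k, a i k • x k
  a_eq_zero : ∀ i, i ∉ P → ∀ p ∈ P, a i (m p) = 0

/-- One elimination step. The pivot row has the least drop in level and the pivot column carries its
leading term; these two choices are what keep both families orthogonal. -/
theorem Matching.step (hV : IsFiltration (K := K) (Γ := Γ) ℓV)
    (hW : IsFiltration (K := K) (Γ := Γ) ℓW) {A : V →ₗ[NovikovField K Γ] W}
    {ι κ : Type} [Fintype ι] [Fintype κ] [DecidableEq ι] [DecidableEq κ]
    (M : Matching ℓV ℓW A ι κ) (h : ∃ i, i ∉ M.P ∧ A (M.y i) ≠ 0) :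
    ∃ M' : Matching ℓV ℓW A ι κ, M.P.card < M'.P.card := by
  classical
  have hne : (Finset.univ.filter fun i => i ∉ M.P ∧ A (M.y i) ≠ 0).Nonempty := by
    obtain ⟨i, hi⟩ := h
    exact ⟨i, by simpa using hi⟩
  obtain ⟨j₀, hj₀, hmax⟩ := Finset.exists_max_image _
    (fun i => (ℓW (A (M.y i))).toReal - (ℓV (M.y i)).toReal) hne
  obtain ⟨hj₀P, hj₀A⟩ : j₀ ∉ M.P ∧ A (M.y j₀) ≠ 0 := by simpa using hj₀
  have hκ : (Finset.univ : Finset κ).Nonempty := by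
    rw [Finset.univ_nonempty_iff]
    by_contra hemp
    rw [not_nonempty_iff] at hemp
    exact hj₀A (by rw [M.map_rest _ hj₀P]; simp)
  obtain ⟨i₀, -, hi₀⟩ := Finset.exists_max_image _ (fun k => ℓW (M.a j₀ k • M.x k)) hκ
  have hlead : ℓW (A (M.y j₀)) ≤ ℓW (M.a j₀ i₀ • M.x i₀) := by
    rw [M.map_rest _ hj₀P]
    exact hW.sum_le _ _ hi₀
  have ha₀ : M.a j₀ i₀ ≠ 0 := by
    intro h0
    rw [h0, zero_smul, hW.zero, le_bot_iff, hW.eq_bot_iff] at hlead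
    exact hj₀A hlead
  have hi₀m : ∀ p ∈ M.P, M.m p ≠ i₀ := by
    intro p hp e
    exact ha₀ (e ▸ M.a_eq_zero _ hj₀P p hp)
  -- The multipliers clear column `i₀`. They are zero on matched rows, whose images have already
  -- been fixed as target vectors.
  set c : ι → NovikovField K Γ := fun i =>
    if i ∈ M.P ∨ i = j₀ then 0 else M.a i i₀ / M.a j₀ i₀ with hc
  have hcP : ∀ i, i ∈ M.P → c i = 0 := fun i hi => by simp [hc, hi]
  have hcj : c j₀ = 0 := by simp [hc]
  have hcle : ∀ i, ℓV (c i • M.y j₀) ≤ ℓV (M.y i) := by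
    intro i
    rcases eq_or_ne (c i) 0 with h0 | h0
    · rw [h0, zero_smul, hV.zero]; exact bot_le
    have hi : ¬ (i ∈ M.P ∨ i = j₀) := fun hi => h0 (by simp [hc, hi])
    have hci : c i = M.a i i₀ / M.a j₀ i₀ := by simp only [hc, if_neg hi]
    rw [not_or] at hi
    have h1 : ℓW (c i • A (M.y j₀)) ≤ ℓW (A (M.y i)) := by
      refine (hW.smul_le_smul hW hlead (c i)).trans ?_
      rw [smul_smul, hci, div_mul_cancel₀ _ ha₀, M.map_rest _ hi.1]
      exact M.orth_x _ _
    have hAi : A (M.y i) ≠ 0 := by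
      intro hz
      rw [hz, hW.zero, le_bot_iff, hW.eq_bot_iff, smul_eq_zero] at h1
      exact h1.elim h0 hj₀A
    -- The bound `h1` holds in the target; since `y j₀` drops no more than `y i`, it passes back to
    -- the source.
    have h2 := hmax i (by simpa using ⟨hi.1, hAi⟩)
    obtain ⟨g, hg⟩ := exists_val_eq h0
    rw [hW.smul, hg, ← hW.coe_toReal hAi, ← hW.coe_toReal hj₀A] at h1
    rw [hV.smul, hg, ← hV.coe_toReal (M.y_ne i), ← hV.coe_toReal (M.y_ne j₀)]
    norm_cast at h1 ⊢
    linarith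
  have hy' : OrthFam K Γ ℓV (fun i => M.y i - c i • M.y j₀) :=
    M.orth_y.shear hV c j₀ hcj hcle
  have hx' : OrthFam K Γ ℓW (Function.update M.x i₀ (A (M.y j₀))) := by
    have := M.orth_x.replace hW (M.a j₀) i₀
    rw [← M.map_rest _ hj₀P] at this
    exact this hlead
  have hlin := M.orth_y.linearIndependent hV M.y_ne
  have hPne : ∀ p ∈ M.P, p ≠ j₀ := fun p hp e => hj₀P (e ▸ hp)
  refine ⟨{
    y := fun i => M.y i - c i • M.y j₀
    x := Function.update M.x i₀ (A (M.y j₀))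
    P := insert j₀ M.P
    m := Function.update M.m j₀ i₀
    orth_y := hy'
    orth_x := hx'
    y_ne := ?_
    x_ne := ?_
    inj := ?_
    map_y := ?_
    a := fun i k => if k = i₀ then 0 else M.a i k - c i * M.a j₀ k
    map_rest := ?_
    a_eq_zero := ?_ }, ?_⟩
  · intro i hi
    rcases eq_or_ne i j₀ with rfl | hij
    · rw [hcj, zero_smul, sub_zero] at hi
      exact M.y_ne _ hi
    -- A vanishing sheared vector would be a dependence with coefficient `1` at `i`.
    · have := Fintype.linearIndependent_iff.1 hlin
        (fun k => (if k = i then 1 else 0) - if k = j₀ then c i else 0) (by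
          simp_rw [sub_smul, Finset.sum_sub_distrib]
          simpa using hi) i
      simp [hij] at this
  · intro k
    rcases eq_or_ne k i₀ with rfl | hk
    · simpa using hj₀A
    · simpa [hk] using M.x_ne k
  · intro p hp q hq hpq
    simp only [Finset.coe_insert, Set.mem_insert_iff, Finset.mem_coe] at hp hq
    rcases hp with rfl | hp <;> rcases hq with rfl | hq
    · rfl
    · rw [Function.update_self, Function.update_of_ne (hPne q hq)] at hpq
      exact absurd hpq.symm (hi₀m q hq)
    · rw [Function.update_self, Function.update_of_ne (hPne p hp)] at hpq
      exact absurd hpq (hi₀m p hp)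
    · rw [Function.update_of_ne (hPne p hp), Function.update_of_ne (hPne q hq)] at hpq
      exact M.inj hp hq hpq
  · intro p hp
    rw [Finset.mem_insert] at hp
    rcases hp with rfl | hp
    · simp [hcj]
    · rw [hcP p hp, Function.update_of_ne (hPne p hp), Function.update_of_ne (hi₀m p hp),
        zero_smul, sub_zero, M.map_y p hp]
  · intro i hi
    rw [Finset.mem_insert, not_or] at hi
    have hci : c i = M.a i i₀ / M.a j₀ i₀ := by simp only [hc, if_neg (not_or.2 ⟨hi.2, hi.1⟩)]
    rw [map_sub, map_smul, M.map_rest i hi.2, M.map_rest j₀ hj₀P, Finset.smul_sum,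
      ← Finset.sum_sub_distrib]
    refine Finset.sum_congr rfl fun k _ => ?_
    rcases eq_or_ne k i₀ with rfl | hk
    · rw [if_pos rfl, zero_smul, smul_smul, ← sub_smul, hci, div_mul_cancel₀ _ ha₀, sub_self,
        zero_smul]
    · rw [if_neg hk, Function.update_of_ne hk, smul_smul, ← sub_smul]
  · intro i hi p hp
    rw [Finset.mem_insert, not_or] at hi
    rw [Finset.mem_insert] at hp
    rcases hp with rfl | hp
    · simp
    · rw [Function.update_of_ne (hPne p hp), if_neg (hi₀m p hp), M.a_eq_zero i hi.2 p hp,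
        M.a_eq_zero j₀ hj₀P p hp]
      simp
  · rw [Finset.card_insert_of_notMem hj₀P]; exact Nat.lt_succ_self _

/-- A matching can be enlarged until the unmatched vectors lie in the kernel. -/
theorem Matching.exists_complete (hV : IsFiltration (K := K) (Γ := Γ) ℓV)
    (hW : IsFiltration (K := K) (Γ := Γ) ℓW) {A : V →ₗ[NovikovField K Γ] W}
    {ι κ : Type} [Fintype ι] [Fintype κ] (M : Matching ℓV ℓW A ι κ) :
    ∃ M' : Matching ℓV ℓW A ι κ, ∀ i, i ∉ M'.P → A (M'.y i) = 0 := by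
  classical
  induction hn : Fintype.card ι - M.P.card using Nat.strong_induction_on generalizing M with
  | _ n ih =>
    by_cases h : ∃ i, i ∉ M.P ∧ A (M.y i) ≠ 0
    · obtain ⟨M', hM'⟩ := M.step hV hW h
      have := Finset.card_le_univ M'.P
      exact ih _ (by omega) M' rfl
    · push Not at h
      exact ⟨M, h⟩

theorem exists_equiv_extending {n r : ℕ} (hr : r ≤ n) {ι : Type} [Fintype ι]
    (hn : Fintype.card ι = n) (f : Fin r → ι) (hf : Function.Injective f) :
    ∃ e : Fin n ≃ ι, ∀ i : Fin r, e (Fin.castLE hr i) = f i := by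
  classical
  -- For `r > 0` the value `f 0` serves as a dummy at indices outside the prescribed range.
  rcases r.eq_zero_or_pos with rfl | hr0
  · exact ⟨(Fintype.equivFinOfCardEq hn).symm, fun i => i.elim0⟩
  obtain ⟨g, hg⟩ := Set.MapsTo.exists_equiv_extend_of_card_eq (α := Fin n) (β := ι)
    (t := Finset.univ) (by simp [hn]) (s := {i | (i : ℕ) < r})
    (f := fun i => if h : (i : ℕ) < r then f ⟨i, h⟩ else f ⟨0, hr0⟩)
    (fun _ _ => by simp) (by
      intro i hi j hj hij
      simp only [Set.mem_ofPred_eq] at hi hj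
      simp only [hi, hj, dif_pos] at hij
      exact Fin.ext (by simpa using hf hij))
  refine ⟨g.trans (Equiv.subtypeUnivEquiv (by simp)), fun i => ?_⟩
  have := hg (Fin.castLE hr i) (by simp)
  simpa using this

theorem OrthFam.exists_basis (hV : IsFiltration (K := K) (Γ := Γ) ℓV) {n : ℕ} {w : Fin n → V}
    (hw : OrthFam K Γ ℓV w) (h0 : ∀ i, w i ≠ 0)
    (hn : n = Module.finrank (NovikovField K Γ) V) [Module.Finite (NovikovField K Γ) V] :
    ∃ b : Module.Basis (Fin n) (NovikovField K Γ) V, ⇑b = w := by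
  have hl := hw.linearIndependent hV h0
  have hs := hl.span_eq_top_of_card_eq_finrank' (by simpa using hn)
  exact ⟨Module.Basis.mk hl hs.ge, Module.Basis.coe_mk _ _⟩

/-- A complete matching is a decomposition up to order: the matched pairs are listed first, by
decreasing length. -/
theorem exists_svd (hV : IsOrthogonalizable (K := K) (Γ := Γ) ℓV)
    (hW : IsOrthogonalizable (K := K) (Γ := Γ) ℓW) (A : V →ₗ[NovikovField K Γ] W) :
    Nonempty (SVD ℓV ℓW A) := by
  classical
  obtain ⟨fV, n, bV, hbV⟩ := hV
  obtain ⟨fW, m, bW, hbW⟩ := hW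
  have finV := Module.Finite.of_basis bV
  have finW := Module.Finite.of_basis bW
  -- The initial matching needs a dummy target index, so a zero target is treated separately.
  rcases m.eq_zero_or_pos with hm0 | hm
  · subst hm0
    have hsub : Subsingleton W := ⟨fun a b => bW.repr.injective (Subsingleton.elim _ _)⟩
    have hA : A = 0 := LinearMap.ext fun _ => Subsingleton.elim _ _
    subst hA
    refine ⟨⟨n, 0, 0, ?_, by simp, by simp, bV, bW, hbV, hbW, ?_, ?_, fun i => i.elim0,
      fun i => i.elim0⟩⟩
    · rw [LinearMap.range_zero, finrank_bot]
    · have : {i : Fin n | 0 ≤ (i : ℕ)} = Set.univ := by ext; simp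
      rw [this, Set.image_univ, bV.span_eq, LinearMap.ker_zero]
    · simp
  obtain ⟨M, hM⟩ := Matching.exists_complete fV fW (A := A) (ι := Fin n) (κ := Fin m)
    { y := bV, x := bW, P := ∅, m := fun _ => ⟨0, hm⟩
      orth_y := (orthFam_iff fV).2 hbV, orth_x := (orthFam_iff fW).2 hbW
      y_ne := bV.ne_zero, x_ne := bW.ne_zero, inj := by simp, map_y := by simp
      a := fun i k => bW.repr (A (bV i)) k
      map_rest := fun i _ => (bW.sum_repr _).symm
      a_eq_zero := by simp }
  set r := M.P.card with hr
  -- enumerate the matched indices by decreasing length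
  set e₀ : Fin r ≃ M.P := M.P.equivFin.symm with he₀
  -- The sign turns the increasing sort into decreasing length.
  set key : Fin r → EReal := fun i => -(ℓV (M.y (e₀ i)) - ℓW (M.x (M.m (e₀ i)))) with hkey
  set τ := Tuple.sort key with hτ
  have hmono : Monotone (key ∘ τ) := Tuple.monotone_sort key
  have hrn : r ≤ n := by simpa using Finset.card_le_univ M.P
  have hrm : r ≤ m := by
    have := Finset.card_le_univ (M.P.image M.m)
    rw [Finset.card_image_of_injOn M.inj] at this
    simpa using this
  obtain ⟨eV, heV⟩ := exists_equiv_extending hrn (Fintype.card_fin n)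
    (fun i => (e₀ (τ i) : Fin n)) (fun i j hij => τ.injective (e₀.injective (Subtype.ext hij)))
  obtain ⟨eW, heW⟩ := exists_equiv_extending hrm (Fintype.card_fin m)
    (fun i => M.m (e₀ (τ i) : Fin n)) (fun i j hij => τ.injective (e₀.injective (Subtype.ext
      (M.inj (e₀ (τ i)).2 (e₀ (τ j)).2 hij))))
  have hyo : OrthFam K Γ ℓV (M.y ∘ eV) := M.orth_y.comp_injective eV.injective
  have hxo : OrthFam K Γ ℓW (M.x ∘ eW) := M.orth_x.comp_injective eW.injective
  obtain ⟨y, hy⟩ := hyo.exists_basis fV (fun i => M.y_ne _)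
    (by rw [Module.finrank_eq_card_basis bV, Fintype.card_fin])
  obtain ⟨x, hx⟩ := hxo.exists_basis fW (fun i => M.x_ne _)
    (by rw [Module.finrank_eq_card_basis bW, Fintype.card_fin])
  have hmap : ∀ i : Fin r, A (y (Fin.castLE hrn i)) = x (Fin.castLE hrm i) := by
    intro i
    rw [hy, hx, Function.comp, Function.comp, heV, heW, M.map_y _ (e₀ (τ i)).2]
  have hzero : ∀ i : Fin n, r ≤ (i : ℕ) → A (y i) = 0 := by
    intro i hi
    rw [hy]
    refine hM _ fun hP => ?_
    have h1 : eV (Fin.castLE hrn (τ.symm (e₀.symm ⟨eV i, hP⟩))) = eV i := by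
      rw [heV]; simp
    have h2 := congrArg Fin.val (eV.injective h1)
    have h3 := (τ.symm (e₀.symm ⟨eV i, hP⟩)).2
    simp only [Fin.val_castLE] at h2
    omega
  have hrange : Submodule.span (NovikovField K Γ) (x '' {i | (i : ℕ) < r}) =
      LinearMap.range A := by
    apply le_antisymm
    · rw [Submodule.span_le]
      rintro _ ⟨i, hi, rfl⟩
      exact ⟨y (Fin.castLE hrn ⟨i, hi⟩), hmap ⟨i, hi⟩⟩
    · rintro _ ⟨v, rfl⟩
      rw [← y.sum_repr v, map_sum]
      refine Submodule.sum_mem _ fun i _ => ?_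
      rw [map_smul]
      refine Submodule.smul_mem _ _ ?_
      by_cases hi : (i : ℕ) < r
      · have := hmap ⟨i, hi⟩
        simp only [Fin.castLE_mk, Fin.eta] at this
        rw [this]
        exact Submodule.subset_span ⟨_, hi, rfl⟩
      · rw [hzero i (not_lt.1 hi)]; exact Submodule.zero_mem _
  have hrx : LinearIndependent (NovikovField K Γ) (fun i : Fin r => x (Fin.castLE hrm i)) :=
    x.linearIndependent.comp _ (Fin.castLE_injective hrm)
  refine ⟨⟨n, m, r, ?_, hrn, hrm, y, x, ?_, ?_, ?_, hrange, hmap, ?_⟩⟩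
  · rw [← hrange]
    have h1 : x '' {i | (i : ℕ) < r} = Set.range (fun i : Fin r => x (Fin.castLE hrm i)) := by
      ext w
      constructor
      · rintro ⟨i, hi, rfl⟩
        exact ⟨⟨i, hi⟩, rfl⟩
      · rintro ⟨i, rfl⟩
        exact ⟨_, i.2, rfl⟩
    rw [h1, finrank_span_eq_card hrx, Fintype.card_fin]
  · rw [hy]; exact (orthFam_iff fV).1 hyo
  · rw [hx]; exact (orthFam_iff fW).1 hxo
  · apply le_antisymm
    · rw [Submodule.span_le]
      rintro _ ⟨i, hi, rfl⟩
      exact hzero i hi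
    · intro v hv
      -- Applying `A` to a kernel vector leaves a relation among the independent `x_i` with `i < r`,
      -- so its first `r` coordinates vanish.
      have hA : ∑ i : Fin r, y.repr v (Fin.castLE hrn i) • x (Fin.castLE hrm i) = 0 := by
        rw [← LinearMap.mem_ker.1 hv]
        conv_rhs => rw [← y.sum_repr v, map_sum]
        symm
        rw [← Finset.sum_subset (Finset.subset_univ
          (Finset.univ.map (Fin.castLEEmb hrn))), Finset.sum_map]
        · exact Finset.sum_congr rfl fun i _ => by rw [map_smul]; exact congrArg _ (hmap i)
        · intro i _ hi
          rw [map_smul, hzero i, smul_zero]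
          by_contra hlt
          exact hi (Finset.mem_map.2 ⟨⟨i, not_le.1 hlt⟩, by simp, rfl⟩)
      have hc := Fintype.linearIndependent_iff.1 hrx _ hA
      rw [← y.sum_repr v]
      refine Submodule.sum_mem _ fun i _ => ?_
      by_cases hi : (i : ℕ) < r
      · have := hc ⟨i, hi⟩
        simp only [Fin.castLE_mk, Fin.eta] at this
        rw [this, zero_smul]; exact Submodule.zero_mem _
      · exact Submodule.smul_mem _ _ (Submodule.subset_span ⟨i, not_lt.1 hi, rfl⟩)
  · intro i j hij
    have := hmono hij
    simp only [hkey, Function.comp, EReal.neg_le_neg_iff] at this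
    rw [hy, hx, Function.comp, Function.comp, Function.comp, Function.comp, heV, heV, heW, heW]
    exact this

end Existence

/-! ### Coordinates, partial inverse and bar lengths of a decomposition. -/

section Bars

variable {K : Type u} [Field K] {Γ : AddSubgroup ℝ}
  {V : Type v} [AddCommGroup V] [Module (NovikovField K Γ) V]
  {W : Type v} [AddCommGroup W] [Module (NovikovField K Γ) W]
  {ℓV : V → EReal} {ℓW : W → EReal} {A : V →ₗ[NovikovField K Γ] W}

namespace SVD

variable (s : SVD ℓV ℓW A)

/-- The partial inverse `x_i ↦ y_i` (`i < r`), `x_i ↦ 0` (`i ≥ r`) of `A`. -/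
noncomputable def lift : W →ₗ[NovikovField K Γ] V :=
  s.x.constr (NovikovField K Γ) fun i =>
    if h : (i : ℕ) < s.r then s.y ⟨i, h.trans_le s.r_le_n⟩ else 0

theorem lift_x_of_lt {i : Fin s.m} (h : (i : ℕ) < s.r) :
    s.lift (s.x i) = s.y ⟨i, h.trans_le s.r_le_n⟩ := by
  rw [lift, Module.Basis.constr_basis, dif_pos h]

theorem lift_x_of_ge {i : Fin s.m} (h : s.r ≤ (i : ℕ)) : s.lift (s.x i) = 0 := by
  rw [lift, Module.Basis.constr_basis, dif_neg (not_lt.2 h)]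

theorem map_y_of_lt {i : Fin s.n} (h : (i : ℕ) < s.r) :
    A (s.y i) = s.x ⟨i, h.trans_le s.r_le_m⟩ := s.map_y ⟨i, h⟩

theorem map_y_of_ge {i : Fin s.n} (h : s.r ≤ (i : ℕ)) : A (s.y i) = 0 := by
  rw [← LinearMap.mem_ker, ← s.span_ker]
  exact Submodule.subset_span ⟨i, h, rfl⟩

theorem map_lift_x_of_lt {i : Fin s.m} (h : (i : ℕ) < s.r) : A (s.lift (s.x i)) = s.x i := by
  rw [s.lift_x_of_lt h, s.map_y_of_lt h]

theorem map_lift_map (v : V) : A (s.lift (A v)) = A v := by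
  have : A ∘ₗ s.lift ∘ₗ A = A := by
    refine s.y.ext fun i => ?_
    simp only [LinearMap.comp_apply]
    by_cases h : (i : ℕ) < s.r
    · rw [s.map_y_of_lt h, s.map_lift_x_of_lt h]
    · rw [s.map_y_of_ge (not_lt.1 h), map_zero, map_zero]
  exact LinearMap.congr_fun this v

theorem lift_map_lift (w : W) : s.lift (A (s.lift w)) = s.lift w := by
  have : s.lift ∘ₗ A ∘ₗ s.lift = s.lift := by
    refine s.x.ext fun i => ?_
    simp only [LinearMap.comp_apply]
    by_cases h : (i : ℕ) < s.r
    · rw [s.map_lift_x_of_lt h]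
    · rw [s.lift_x_of_ge (not_lt.1 h), map_zero, map_zero]
  exact LinearMap.congr_fun this w

theorem repr_map_of_ge (v : V) {i : Fin s.m} (h : s.r ≤ (i : ℕ)) : s.x.repr (A v) i = 0 := by
  have : s.x.coord i ∘ₗ A = 0 := by
    refine s.y.ext fun j => ?_
    by_cases hj : (j : ℕ) < s.r
    · have hne : (⟨j, hj.trans_le s.r_le_m⟩ : Fin s.m) ≠ i := by
        intro e
        have := congrArg Fin.val e
        simp only at this
        omega
      simp [s.map_y_of_lt hj, Finsupp.single_eq_of_ne' hne]
    · simp [s.map_y_of_ge (not_lt.1 hj)]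
  exact LinearMap.congr_fun this v

theorem repr_map_of_lt (v : V) {i : Fin s.m} (h : (i : ℕ) < s.r) :
    s.x.repr (A v) i = s.y.repr v ⟨i, h.trans_le s.r_le_n⟩ := by
  have : s.x.coord i ∘ₗ A = s.y.coord ⟨i, h.trans_le s.r_le_n⟩ := by
    refine s.y.ext fun j => ?_
    by_cases hj : (j : ℕ) < s.r
    · simp [s.map_y_of_lt hj, Finsupp.single_apply, Fin.ext_iff]
    · have hne : j ≠ ⟨i, h.trans_le s.r_le_n⟩ := by
        intro e
        have := congrArg Fin.val e
        simp only at this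
        omega
      simp [s.map_y_of_ge (not_lt.1 hj), Finsupp.single_eq_of_ne' hne]
  exact LinearMap.congr_fun this v

variable (hV : IsFiltration (K := K) (Γ := Γ) ℓV) (hW : IsFiltration (K := K) (Γ := Γ) ℓW)

include hV in
theorem orth_y : OrthFam K Γ ℓV s.y := (orthFam_iff hV).2 s.y_orthogonal

include hW in
theorem orth_x : OrthFam K Γ ℓW s.x := (orthFam_iff hW).2 s.x_orthogonal

include hW in
theorem repr_smul_le (w : W) (i : Fin s.m) : ℓW (s.x.repr w i • s.x i) ≤ ℓW w := by
  have := s.orth_x hW (fun i => s.x.repr w i) i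
  rwa [s.x.sum_repr] at this

include hV in
theorem repr_map_smul_le (v : V) (i : Fin s.m) :
    ℓV (s.x.repr (A v) i • s.lift (s.x i)) ≤ ℓV v := by
  by_cases h : (i : ℕ) < s.r
  · rw [s.repr_map_of_lt v h, s.lift_x_of_lt h]
    have := s.orth_y hV (fun i => s.y.repr v i) ⟨i, h.trans_le s.r_le_n⟩
    rwa [s.y.sum_repr] at this
  · rw [s.lift_x_of_ge (not_lt.1 h), smul_zero, hV.zero]; exact bot_le

include hV in
-- `lift ∘ A` is the coordinate projection onto the `y_i` with `i < r`, and orthogonality makes such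
-- projections filtered.
theorem lift_map_le (v : V) : ℓV (s.lift (A v)) ≤ ℓV v := by
  rw [← s.x.sum_repr (A v), map_sum]
  refine hV.sum_le _ _ fun i _ => ?_
  rw [map_smul]
  exact s.repr_map_smul_le hV v i

/-- The bar of index `i`. -/
noncomputable def bar (i : Fin s.m) : (ℝ ⧸ Γ) × ℝ≥0∞ :=
  (((ℓW (s.x i)).toReal : ℝ ⧸ Γ),
    if h : (i : ℕ) < s.r then
      (ℓV (s.y ⟨i, h.trans_le s.r_le_n⟩) - ℓW (s.x i)).toENNReal
    else ∞)

theorem bars_eq : s.bars = (Finset.univ : Finset (Fin s.m)).val.map s.bar := rfl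

theorem bar_snd_of_ge {i : Fin s.m} (h : s.r ≤ (i : ℕ)) : (s.bar i).2 = ∞ :=
  dif_neg (not_lt.2 h)

include hV hW in
theorem exists_length (hA : ∀ v, ℓW (A v) ≤ ℓV v) {i : Fin s.m} (h : (i : ℕ) < s.r) :
    ∃ σ : ℝ, 0 ≤ σ ∧ ℓV (s.lift (s.x i)) = ℓW (s.x i) + σ ∧ (s.bar i).2 = ENNReal.ofReal σ := by
  have hle := hA (s.lift (s.x i))
  rw [s.map_lift_x_of_lt h, s.lift_x_of_lt h] at hle
  have h2 : (s.bar i).2 = (ℓV (s.y ⟨i, h.trans_le s.r_le_n⟩) - ℓW (s.x i)).toENNReal :=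
    dif_pos h
  rw [h2, s.lift_x_of_lt h]
  rw [← hV.coe_toReal (s.y.ne_zero ⟨i, h.trans_le s.r_le_n⟩), ← hW.coe_toReal (s.x.ne_zero i)]
    at hle ⊢
  refine ⟨(ℓV (s.y ⟨i, h.trans_le s.r_le_n⟩)).toReal - (ℓW (s.x i)).toReal, ?_, ?_, ?_⟩
  · have := EReal.coe_le_coe_iff.1 hle
    linarith
  · norm_cast
    ring
  · rw [← EReal.coe_sub, EReal.toENNReal_of_ne_top (EReal.coe_ne_top _), EReal.toReal_coe]

include hV hW in
theorem bar_snd_ne_top_iff (hA : ∀ v, ℓW (A v) ≤ ℓV v) {i : Fin s.m} :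
    (s.bar i).2 ≠ ∞ ↔ (i : ℕ) < s.r := by
  constructor
  · intro h
    by_contra hi
    exact h (s.bar_snd_of_ge (not_lt.1 hi))
  · intro h
    obtain ⟨σ, -, -, h2⟩ := s.exists_length hV hW hA h
    rw [h2]; exact ENNReal.ofReal_ne_top

include hW in
/-- Rescaling a basis vector to any level in the class given by its bar. -/
theorem exists_smul_level {i : Fin s.m} {t : ℝ} :
    (s.bar i).1 = (t : ℝ ⧸ Γ) ↔
      ∃ a : NovikovField K Γ, a ≠ 0 ∧ ℓW (a • s.x i) = t := by
  have h0 : (s.bar i).1 = (((ℓW (s.x i)).toReal : ℝ) : ℝ ⧸ Γ) := rfl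
  rw [h0, eq_comm, QuotientAddGroup.eq]
  constructor
  · intro h
    obtain ⟨g, hg⟩ : ∃ g : Γ, (g : ℝ) = -t + (ℓW (s.x i)).toReal := ⟨⟨_, h⟩, rfl⟩
    refine ⟨mono K g, mono_ne_zero _, ?_⟩
    rw [hW.smul, val_mono, hg, ← hW.coe_toReal (s.x.ne_zero i), EReal.toReal_coe]
    norm_cast
    ring
  · rintro ⟨a, ha, hat⟩
    obtain ⟨g, hg⟩ := exists_val_eq ha
    rw [hW.smul, hg, ← hW.coe_toReal (s.x.ne_zero i)] at hat
    have h1 : (ℓW (s.x i)).toReal - (g : ℝ) = t := by exact_mod_cast hat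
    have h2 : -t + (ℓW (s.x i)).toReal = g := by linarith
    rw [h2]
    exact g.2

end SVD

/-- The kernel of a linear map between orthogonalizable spaces is orthogonalizable. -/
theorem IsOrthogonalizable.ker (hV : IsOrthogonalizable (K := K) (Γ := Γ) ℓV)
    (hW : IsOrthogonalizable (K := K) (Γ := Γ) ℓW) (A : V →ₗ[NovikovField K Γ] W) :
    IsOrthogonalizable (K := K) (Γ := Γ) fun z : LinearMap.ker A => ℓV z := by
  obtain ⟨s⟩ := exists_svd hV hW A
  have hf := hV.filtration
  have hfin : Module.Finite (NovikovField K Γ) V := Module.Finite.of_basis s.y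
  -- The tail of the source basis of a decomposition is an orthogonal basis of the kernel.
  set w : Fin (s.n - s.r) → LinearMap.ker A := fun i =>
    ⟨s.y ⟨s.r + i, by omega⟩, s.map_y_of_ge (by simp)⟩ with hw
  have hinj : Function.Injective fun i : Fin (s.n - s.r) => (⟨s.r + i, by omega⟩ : Fin s.n) := by
    intro i j hij
    have := congrArg Fin.val hij
    simp only at this
    exact Fin.ext (by omega)
  have hfz := hf.subspace (LinearMap.ker A)
  have ho : OrthFam K Γ (fun z : LinearMap.ker A => ℓV z) w := by
    intro a i
    have := (s.orth_y hf).comp_injective hinj a i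
    simpa [hw] using this
  have hcard : s.n - s.r = Module.finrank (NovikovField K Γ) (LinearMap.ker A) := by
    have h1 := LinearMap.finrank_range_add_finrank_ker A
    rw [← s.r_eq, Module.finrank_eq_card_basis s.y, Fintype.card_fin] at h1
    omega
  obtain ⟨b, hb⟩ := ho.exists_basis hfz
    (fun i h => s.y.ne_zero _ (congrArg Subtype.val h)) hcard
  refine ⟨hfz, _, b, ?_⟩
  rw [hb]
  exact (orthFam_iff hfz).1 ho

end Bars

/-! ### Multiplicities of bars under filtered comparison maps. -/

section Comparison

variable {K : Type u} [Field K] {Γ : AddSubgroup ℝ}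
  {V : Type v} [AddCommGroup V] [Module (NovikovField K Γ) V]
  {W : Type v} [AddCommGroup W] [Module (NovikovField K Γ) W]
  {ℓV : V → EReal} {ℓW : W → EReal} {A : V →ₗ[NovikovField K Γ] W}
  {V' : Type v} [AddCommGroup V'] [Module (NovikovField K Γ) V']
  {W' : Type v} [AddCommGroup W'] [Module (NovikovField K Γ) W']
  {ℓV' : V' → EReal} {ℓW' : W' → EReal} {A' : V' →ₗ[NovikovField K Γ] W'}

theorem OrthFam.smul {ι : Type*} [Fintype ι] {w : ι → W} (h : OrthFam K Γ ℓW w)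
    (c : ι → NovikovField K Γ) : OrthFam K Γ ℓW (fun i => c i • w i) := by
  intro a i
  simpa [mul_smul] using h (fun i => a i * c i) i

theorem IsFiltration.smul_level_le_iff (hW : IsFiltration (K := K) (Γ := Γ) ℓW) {z : W} {t : ℝ}
    (hz : ℓW z = t) (a : NovikovField K Γ) : ℓW (a • z) ≤ t ↔ 0 ≤ val a := by
  rw [hW.smul, hz]
  rcases eq_or_ne a 0 with rfl | ha
  · simp [val_zero]
  · obtain ⟨g, hg⟩ := exists_val_eq ha
    rw [hg]
    norm_cast
    constructor <;> intro h <;> linarith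

theorem IsFiltration.smul_level_lt_iff (hW : IsFiltration (K := K) (Γ := Γ) ℓW) {z : W} {t : ℝ}
    (hz : ℓW z = t) (a : NovikovField K Γ) : ℓW (a • z) < t ↔ 0 < val a := by
  rw [hW.smul, hz]
  rcases eq_or_ne a 0 with rfl | ha
  · simp [val_zero, EReal.bot_lt_coe]
  · obtain ⟨g, hg⟩ := exists_val_eq ha
    rw [hg]
    norm_cast
    constructor <;> intro h <;> linarith

/-- Comparing an orthogonal family on a fixed level with a family of functionals through the
leading coefficients. -/
theorem card_le_of_leading_coeff (hW : IsFiltration (K := K) (Γ := Γ) ℓW) {I J : Type*}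
    [Fintype I] [Fintype J] {p : I → W} (hp : OrthFam K Γ ℓW p) {t : ℝ} (hpt : ∀ i, ℓW (p i) = t)
    (Q : J → W →ₗ[NovikovField K Γ] NovikovField K Γ)
    (h1 : ∀ w, ℓW w ≤ t → ∀ j, 0 ≤ val (Q j w))
    (h2 : ∀ a : I → NovikovField K Γ, ℓW (∑ i, a i • p i) ≤ t →
      (∀ j, 0 < val (Q j (∑ i, a i • p i))) → ℓW (∑ i, a i • p i) < t) :
    Fintype.card I ≤ Fintype.card J := by
  -- Restricting to constant coefficients reduces the comparison to dimensions over `K`. On level at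
  -- most `t` the functionals have non-negative valuation, so a zero coefficient at `T^0` means
  -- positive valuation.
  let F : (I → K) →ₗ[K] (J → K) :=
    { toFun := fun k j => coeffZero (Q j (∑ i, const K Γ (k i) • p i))
      map_add' := by
        intro k l
        funext j
        simp only [Pi.add_apply, map_add, add_smul, Finset.sum_add_distrib, coeffZero_add]
      map_smul' := by
        intro c k
        funext j
        simp only [Pi.smul_apply, smul_eq_mul, map_mul, mul_smul, RingHom.id_apply]
        rw [← Finset.smul_sum, map_smul, smul_eq_mul, coeffZero_const_mul] }
  have hF : Function.Injective F := by
    rw [← LinearMap.ker_eq_bot, LinearMap.ker_eq_bot']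
    intro k hk
    have hle : ∀ i, ℓW (const K Γ (k i) • p i) ≤ t := by
      intro i
      rw [hW.smul_level_le_iff (hpt i)]
      rcases eq_or_ne (k i) 0 with h | h
      · rw [h, map_zero, val_zero]; exact le_top
      · rw [val_const h]
    have hsum := hW.sum_le Finset.univ (fun i => const K Γ (k i) • p i) fun i _ => hle i
    have hlt := h2 (fun i => const K Γ (k i)) hsum fun j =>
      val_pos_of_coeffZero_eq_zero (h1 _ hsum j) (congrFun hk j)
    funext i
    by_contra hne
    have h3 := (hp (fun i => const K Γ (k i)) i).trans_lt hlt
    simp only [hW.smul_level_lt_iff (hpt i)] at h3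
    rw [val_const hne] at h3
    exact lt_irrefl _ h3
  simpa using LinearMap.finrank_le_finrank_of_injective hF

open Classical in
theorem SVD.count_bars (s : SVD ℓV ℓW A) (b : (ℝ ⧸ Γ) × ℝ≥0∞) :
    s.bars.count b = Fintype.card {i // s.bar i = b} := by
  rw [s.bars_eq, Multiset.count_map, Fintype.card_subtype]
  simp only [eq_comm (a := b)]
  rfl

/-- Two linear maps between filtered spaces, with filtered comparison maps that are inverse to
each other in one direction up to a filtered homotopy. -/
structure Comparison (ℓV : V → EReal) (ℓW : W → EReal) (A : V →ₗ[NovikovField K Γ] W)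
    (ℓV' : V' → EReal) (ℓW' : W' → EReal) (A' : V' →ₗ[NovikovField K Γ] W') where
  Φ : W →ₗ[NovikovField K Γ] W'
  ΦV : V →ₗ[NovikovField K Γ] V'
  Ψ : W' →ₗ[NovikovField K Γ] W
  ΨV : V' →ₗ[NovikovField K Γ] V
  H : W → V
  Φ_le : ∀ w, ℓW' (Φ w) ≤ ℓW w
  ΦV_le : ∀ v, ℓV' (ΦV v) ≤ ℓV v
  Ψ_le : ∀ w, ℓW (Ψ w) ≤ ℓW' w
  ΨV_le : ∀ v, ℓV (ΨV v) ≤ ℓV' v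
  H_le : ∀ w, ℓV (H w) ≤ ℓW w
  Φ_map : ∀ v, Φ (A v) = A' (ΦV v)
  Ψ_map : ∀ v, Ψ (A' v) = A (ΨV v)
  Ψ_Φ : ∀ w, Ψ (Φ w) = w + A (H w)

open Classical in
-- The homotopy can disturb only bars of length zero, as it raises no level while a bar of length `σ
-- > 0` needs a primitive `σ` higher; hence `hb` asks for zero homotopy only there.
theorem Comparison.count_le (M : Comparison ℓV ℓW A ℓV' ℓW' A')
    (hV : IsFiltration (K := K) (Γ := Γ) ℓV) (hW : IsFiltration (K := K) (Γ := Γ) ℓW)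
    (hV' : IsFiltration (K := K) (Γ := Γ) ℓV') (hW' : IsFiltration (K := K) (Γ := Γ) ℓW')
    (hA : ∀ v, ℓW (A v) ≤ ℓV v) (hA' : ∀ v, ℓW' (A' v) ≤ ℓV' v)
    (s : SVD ℓV ℓW A) (s' : SVD ℓV' ℓW' A') (b : (ℝ ⧸ Γ) × ℝ≥0∞)
    (hb : b.2 = 0 → ∀ w, M.H w = 0) : s.bars.count b ≤ s'.bars.count b := by
  obtain ⟨τ, len⟩ := b
  obtain ⟨t, rfl⟩ := QuotientAddGroup.mk_surjective τ
  simp only at hb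
  rw [s.count_bars, s'.count_bars]
  choose α hα0 hα using fun i : {i // s.bar i = ((t : ℝ ⧸ Γ), len)} =>
    (s.exists_smul_level hW (i := i.1) (t := t)).1 (by rw [i.2])
  choose β hβ0 hβ using fun j : {j // s'.bar j = ((t : ℝ ⧸ Γ), len)} =>
    (s'.exists_smul_level hW' (i := j.1) (t := t)).1 (by rw [j.2])
  have hQ : ∀ j w, (((β j)⁻¹ • (s'.x.coord j.1 ∘ₗ M.Φ)) w) • (β j • s'.x j.1) =
      s'.x.repr (M.Φ w) j.1 • s'.x j.1 := by
    intro j w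
    rw [smul_smul]
    congr 1
    simp only [LinearMap.smul_apply, LinearMap.comp_apply, Module.Basis.coord_apply, smul_eq_mul]
    rw [mul_comm, mul_inv_cancel_left₀ (hβ0 j)]
  refine card_le_of_leading_coeff hW (p := fun i => α i • s.x i.1) (t := t)
    (((s.orth_x hW).comp_injective Subtype.val_injective).smul α) hα
    (fun j => (β j)⁻¹ • (s'.x.coord j.1 ∘ₗ M.Φ)) ?_ ?_
  · intro w hw j
    rw [← hW'.smul_level_le_iff (hβ j), hQ]
    exact (s'.repr_smul_le hW' _ _).trans ((M.Φ_le w).trans hw)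
  intro a hv hJ
  set v := ∑ i, a i • α i • s.x i.1 with hvdef
  have hΦv : ℓW' (M.Φ v) ≤ t := (M.Φ_le v).trans hv
  have hle : ∀ j, ℓW' (s'.x.repr (M.Φ v) j • s'.x j) ≤ t := fun j =>
    (s'.repr_smul_le hW' _ _).trans hΦv
  have hlt : ∀ j, (s'.bar j).2 = len → ℓW' (s'.x.repr (M.Φ v) j • s'.x j) < t := by
    intro j hj
    -- A coordinate at level exactly `t` forces the class of bar `j` to be `[t]`, so `j` is among
    -- the indices tested by `hJ`.
    refine lt_of_le_of_ne (hle j) fun he => ?_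
    have hne : s'.x.repr (M.Φ v) j ≠ 0 := by
      intro h0
      rw [h0, zero_smul, hW'.zero] at he
      exact EReal.bot_ne_coe t he
    have h1 := (s'.exists_smul_level hW' (i := j) (t := t)).2 ⟨_, hne, he⟩
    have h2 := hJ ⟨j, Prod.ext h1 hj⟩
    rw [← hW'.smul_level_lt_iff (hβ _), hQ] at h2
    exact absurd he h2.ne
  have hterm : ∀ i, ℓW (a i • α i • s.x i.1) ≤ t := fun i =>
    ((((s.orth_x hW).comp_injective Subtype.val_injective).smul α) a i).trans hv
  have hcoord : ∀ i, s.x.repr v i.1 • s.x i.1 = a i • α i • s.x i.1 := by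
    intro i
    rw [smul_smul]
    congr 1
    rw [hvdef, map_sum, Finsupp.finsetSum_apply, Finset.sum_eq_single i]
    · simp
    · intro k _ hk
      simp [Finsupp.single_eq_of_ne' (fun e : k.1 = i.1 => hk (Subtype.ext e))]
    · simp
  have hback : ∀ z d, M.Φ v = z + A' d → v = M.Ψ z + A (M.ΨV d - M.H v) := by
    intro z d h
    have h1 := M.Ψ_Φ v
    rw [h, map_add, M.Ψ_map] at h1
    rw [map_sub, ← add_sub_assoc, h1, add_sub_cancel_right]
  suffices hcl : ∀ i, ℓW (a i • α i • s.x i.1) < t from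
    hW.sum_lt _ _ (EReal.bot_lt_coe t) fun i _ => hcl i
  have hfinish : ∀ z e, ℓW' z < t → v = M.Ψ z + A e →
      ∀ i : {i // s.bar i = ((t : ℝ ⧸ Γ), len)}, ℓW (s.x.repr (A e) i.1 • s.x i.1) < t →
      ℓW (a i • α i • s.x i.1) < t := by
    intro z e hz hve i hi
    rw [← hcoord i]
    have : s.x.repr v i.1 • s.x i.1 =
        s.x.repr (M.Ψ z) i.1 • s.x i.1 + s.x.repr (A e) i.1 • s.x i.1 := by
      conv_lhs => rw [hve]
      rw [map_add, Finsupp.add_apply, add_smul]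
    rw [this]
    exact (hW.add_le _ _).trans_lt (max_lt
      ((s.repr_smul_le hW _ _).trans_lt ((M.Ψ_le z).trans_lt hz)) hi)
  rcases eq_or_ne len ∞ with rfl | hlen
  -- Infinite bars: `z` is the part of `Φ v` along the `x'_j` with `j ≥ r`, and boundaries have no
  -- coordinates along the infinite bars of `s`.
  · set z := M.Φ v - A' (s'.lift (M.Φ v)) with hz
    have hzlt : ℓW' z < t := by
      have : z = ∑ j, s'.x.repr (M.Φ v) j • (s'.x j - A' (s'.lift (s'.x j))) := by
        conv_lhs => rw [hz, ← s'.x.sum_repr (M.Φ v)]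
        simp only [map_sum, map_smul, smul_sub, Finset.sum_sub_distrib]
      rw [this]
      refine hW'.sum_lt _ _ (EReal.bot_lt_coe t) fun j _ => ?_
      by_cases hj : (j : ℕ) < s'.r
      · rw [s'.map_lift_x_of_lt hj, sub_self, smul_zero, hW'.zero]
        exact EReal.bot_lt_coe t
      · rw [s'.lift_x_of_ge (not_lt.1 hj), map_zero, sub_zero]
        exact hlt j (s'.bar_snd_of_ge (not_lt.1 hj))
    have hv2 := hback z _ (by rw [hz, sub_add_cancel])
    intro i
    refine hfinish z _ hzlt hv2 i ?_
    rw [s.repr_map_of_ge, zero_smul, hW.zero]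
    · exact EReal.bot_lt_coe t
    · by_contra hi
      exact (s.bar_snd_ne_top_iff hV hW hA).2 (not_le.1 hi) (by rw [i.2])
  · obtain ⟨σ, hσ0, hσ⟩ : ∃ σ : ℝ, 0 ≤ σ ∧ len = ENNReal.ofReal σ :=
      ⟨len.toReal, ENNReal.toReal_nonneg, (ENNReal.ofReal_toReal hlen).symm⟩
    have hir : ∀ i : {i // s.bar i = ((t : ℝ ⧸ Γ), len)}, (i.1 : ℕ) < s.r := fun i =>
      (s.bar_snd_ne_top_iff hV hW hA).1 (by rw [i.2]; exact hlen)
    have hlift : ∀ i : {i // s.bar i = ((t : ℝ ⧸ Γ), len)},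
        ℓV (s.lift (s.x i.1)) = ℓW (s.x i.1) + σ := by
      intro i
      obtain ⟨σ', h0, h1, h2⟩ := s.exists_length hV hW hA (hir i)
      rw [i.2, hσ, ENNReal.ofReal_eq_ofReal_iff hσ0 h0] at h2
      rw [h1, h2]
    have hu : A (s.lift v) = v := by
      rw [hvdef, map_sum, map_sum]
      refine Finset.sum_congr rfl fun i _ => ?_
      simp only [map_smul]
      rw [s.map_lift_x_of_lt (hir i)]
    have hule : ℓV (s.lift v) ≤ t + σ := by
      rw [hvdef, map_sum]
      refine hV.sum_le _ _ fun i _ => ?_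
      simp only [map_smul]
      rw [hV.smul_eq_add hW (hV.smul_eq_add hW (hlift i) (α i)) (a i)]
      exact add_le_add (hterm i) le_rfl
    have hΦu : M.Φ v = A' (M.ΦV (s.lift v)) := by rw [← M.Φ_map, hu]
    have hle2 : ∀ j, ℓV' (s'.x.repr (M.Φ v) j • s'.lift (s'.x j)) ≤ t + σ := by
      intro j
      rw [hΦu]
      exact (s'.repr_map_smul_le hV' _ j).trans ((M.ΦV_le _).trans hule)
    have hbot : (⊥ : EReal) < t + σ := by
      rw [← EReal.coe_add]; exact EReal.bot_lt_coe _
    -- Terms whose lift is below `t + σ` go into `d`. The others have lift at level exactly `t + σ`;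
    -- were such a term itself at level `t`, its bar would have length `σ`, which `hlt` excludes. So
    -- they form a `z` below `t`.
    set d := ∑ j, if ℓV' (s'.x.repr (M.Φ v) j • s'.lift (s'.x j)) < t + σ then
      s'.x.repr (M.Φ v) j • s'.lift (s'.x j) else 0 with hd
    set z := ∑ j, if ℓV' (s'.x.repr (M.Φ v) j • s'.lift (s'.x j)) < t + σ then 0 else
      s'.x.repr (M.Φ v) j • s'.x j with hz
    have hdlt : ℓV' d < t + σ := by
      refine hV'.sum_lt _ _ hbot fun j _ => ?_
      split_ifs with h
      · exact h
      · rw [hV'.zero]; exact hbot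
    have hzlt : ℓW' z < t := by
      refine hW'.sum_lt _ _ (EReal.bot_lt_coe t) fun j _ => ?_
      split_ifs with h
      · rw [hW'.zero]; exact EReal.bot_lt_coe t
      · have hj : (j : ℕ) < s'.r := by
          by_contra hj
          rw [s'.lift_x_of_ge (not_lt.1 hj), smul_zero, hV'.zero] at h
          exact h hbot
        obtain ⟨σ', h0, h1, h2⟩ := s'.exists_length hV' hW' hA' hj
        refine lt_of_le_of_ne (hle j) fun he => ?_
        have h3 := le_antisymm (hle2 j) (not_lt.1 h)
        rw [hV'.smul_eq_add hW' h1, he] at h3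
        have h4 : t + σ' = t + σ := by exact_mod_cast h3
        have h5 : σ' = σ := by linarith
        exact (hlt j (by rw [h2, hσ, h5])).ne he
    have hdec : M.Φ v = z + A' d := by
      rw [hd, hz, map_sum A', ← Finset.sum_add_distrib]
      conv_lhs => rw [← s'.x.sum_repr (M.Φ v)]
      refine Finset.sum_congr rfl fun j _ => ?_
      split_ifs with h
      · rw [zero_add, map_smul]
        by_cases hj : (j : ℕ) < s'.r
        · rw [s'.map_lift_x_of_lt hj]
        -- Terms with `j ≥ r` have zero lift and so fall in `d`; nothing is lost because `Φ v` is a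
        -- boundary.
        · rw [hΦu, s'.repr_map_of_ge _ (not_lt.1 hj), zero_smul, zero_smul]
      · rw [map_zero, add_zero]
    have hv2 := hback z d hdec
    have he : ℓV (M.ΨV d - M.H v) < t + σ := by
      refine (hV.sub_le _ _).trans_lt (max_lt ((M.ΨV_le d).trans_lt hdlt) ?_)
      -- The homotopy term has level at most `t`, strictly below `t + σ` unless `σ = 0`.
      rcases hσ0.eq_or_lt with h0 | h0
      · rw [hb (by rw [hσ, ← h0, ENNReal.ofReal_zero]), hV.zero]; exact hbot
      · refine ((M.H_le v).trans hv).trans_lt ?_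
        rw [← EReal.coe_add, EReal.coe_lt_coe_iff]
        linarith
    intro i
    refine hfinish z _ hzlt hv2 i ?_
    have h1 := (s.repr_map_smul_le hV (M.ΨV d - M.H v) i.1).trans_lt he
    rw [hV.smul_eq_add hW (hlift i)] at h1
    by_contra hcon
    exact absurd h1 (not_lt.2 (add_le_add (not_lt.1 hcon) le_rfl))

/-- The bars do not depend on the singular value decomposition. -/
theorem SVD.bars_unique (hV : IsFiltration (K := K) (Γ := Γ) ℓV)
    (hW : IsFiltration (K := K) (Γ := Γ) ℓW) (hA : ∀ v, ℓW (A v) ≤ ℓV v)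
    (s s' : SVD ℓV ℓW A) : s.bars = s'.bars := by
  classical
  let M : Comparison ℓV ℓW A ℓV ℓW A :=
    { Φ := LinearMap.id, ΦV := LinearMap.id, Ψ := LinearMap.id, ΨV := LinearMap.id
      H := fun _ => 0
      Φ_le := fun _ => le_rfl, ΦV_le := fun _ => le_rfl
      Ψ_le := fun _ => le_rfl, ΨV_le := fun _ => le_rfl
      H_le := fun _ => by rw [hV.zero]; exact bot_le
      Φ_map := fun _ => rfl, Ψ_map := fun _ => rfl
      Ψ_Φ := fun w => by simp }
  refine Multiset.ext.2 fun b => le_antisymm ?_ ?_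
  · convert M.count_le hV hW hV hW hA hA s s' b fun _ _ => rfl
  · convert M.count_le hV hW hV hW hA hA s' s b fun _ _ => rfl

end Comparison

/-! ### Well-defined barcodes and invariance under filtered homotopy equivalence. -/

namespace FloerComplex

variable {K : Type u} [Field K] {Γ : AddSubgroup ℝ}

noncomputable instance instAddCommGroupX (C : FloerComplex.{u, v} K Γ) (k : ℤ) :
    AddCommGroup (C.cx.X k) := inferInstance

noncomputable instance instAddCommMonoidX (C : FloerComplex.{u, v} K Γ) (k : ℤ) :
    AddCommMonoid (C.cx.X k) := inferInstance

noncomputable instance instModuleX (C : FloerComplex.{u, v} K Γ) (k : ℤ) :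
    Module (NovikovField K Γ) (C.cx.X k) := inferInstance

noncomputable instance instAddCommMonoidCycles (C : FloerComplex.{u, v} K Γ) (k : ℤ) :
    AddCommMonoid (C.cycles k) := inferInstance

noncomputable instance instAddCommGroupCycles (C : FloerComplex.{u, v} K Γ) (k : ℤ) :
    AddCommGroup (C.cycles k) := inferInstance

noncomputable instance instModuleCycles (C : FloerComplex.{u, v} K Γ) (k : ℤ) :
    Module (NovikovField K Γ) (C.cycles k) := inferInstance

theorem filtration (C : FloerComplex.{u, v} K Γ) (k : ℤ) :
    IsFiltration (K := K) (Γ := Γ) (C.ℓ k) := (C.orthogonalizable k).filtration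

theorem d_le (C : FloerComplex.{u, v} K Γ) {i j : ℤ} (h : j + 1 = i) (x : C.cx.X i) :
    C.ℓ j (C.cx.d i j x) ≤ C.ℓ i x := by
  obtain rfl : j = i - 1 := by omega
  exact C.boundary_le i x

theorem d_d (C : FloerComplex.{u, v} K Γ) (i j k : ℤ) (x : C.cx.X i) :
    C.cx.d j k (C.cx.d i j x) = 0 :=
  congrArg (fun f => f.hom x) (C.cx.d_comp_d i j k)

theorem map_d {C D : FloerComplex.{u, v} K Γ} (Φ : C.cx ⟶ D.cx) (i j : ℤ) (x : C.cx.X i) :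
    D.cx.d i j (Φ.f i x) = Φ.f j (C.cx.d i j x) :=
  congrArg (fun f => f.hom x) (Φ.comm i j)

theorem cycles_filtration (C : FloerComplex.{u, v} K Γ) (k : ℤ) :
    IsFiltration (K := K) (Γ := Γ) fun z : C.cycles k => C.ℓ k z :=
  (C.filtration k).subspace _

theorem cycles_orthogonalizable (C : FloerComplex.{u, v} K Γ) (k : ℤ) :
    IsOrthogonalizable (K := K) (Γ := Γ) fun z : C.cycles k => C.ℓ k z :=
  (C.orthogonalizable k).ker (C.orthogonalizable (k - 1)) _

theorem boundary_le_level (C : FloerComplex.{u, v} K Γ) (k : ℤ) (x : C.cx.X (k + 1)) :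
    C.ℓ k (C.boundary k x) ≤ C.ℓ (k + 1) x := C.d_le rfl x

theorem nonempty_boundarySVD (C : FloerComplex.{u, v} K Γ) (k : ℤ) :
    Nonempty (C.BoundarySVD k) :=
  exists_svd (C.orthogonalizable (k + 1)) (C.cycles_orthogonalizable k) (C.boundary k)

theorem bars_eq_verboseBarcode (C : FloerComplex.{u, v} K Γ) {k : ℤ} (s : C.BoundarySVD k) :
    s.bars = C.verboseBarcode k := by
  rw [verboseBarcode, dif_pos (C.nonempty_boundarySVD k)]
  exact SVD.bars_unique (C.filtration (k + 1)) (C.cycles_filtration k) (C.boundary_le_level k) _ _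

theorem barcodesWellDefined (C : FloerComplex.{u, v} K Γ) : C.BarcodesWellDefined := fun k =>
  ⟨C.nonempty_boundarySVD k, C.bars_eq_verboseBarcode⟩

/-- The map induced on cycles. -/
noncomputable def cyclesMap {C D : FloerComplex.{u, v} K Γ} (Φ : C.cx ⟶ D.cx) (k : ℤ) :
    C.cycles k →ₗ[NovikovField K Γ] D.cycles k :=
  (Φ.f k).hom.restrict fun x hx => by
    have h := map_d Φ k (k - 1) x
    have hx' : C.cx.d k (k - 1) x = 0 := hx
    rw [hx', map_zero] at h
    exact h

/-- The term of the homotopy formula that passes through the boundary of `z` vanishes on cycles,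
leaving the identity `Ψ_Φ` required of a comparison. -/
theorem homotopy_apply_cycle {C : FloerComplex.{u, v} K Γ} {f : C.cx ⟶ C.cx}
    (h : Homotopy f (𝟙 C.cx)) (k : ℤ) (z : C.cx.X k) (hz : C.cx.d k (k - 1) z = 0) :
    f.f k z = z + C.cx.d (k + 1) k (h.hom k (k + 1) z) := by
  have h1 := h.comm k
  rw [dNext_eq h.hom (show (ComplexShape.down ℤ).Rel k (k - 1) by simp),
    prevD_eq h.hom (show (ComplexShape.down ℤ).Rel (k + 1) k by simp)] at h1
  have h2 := congrArg (fun g => g.hom z) h1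
  simp only [ModuleCat.hom_add, ModuleCat.hom_comp, LinearMap.add_apply, LinearMap.comp_apply,
    HomologicalComplex.id_f, ModuleCat.hom_id, LinearMap.id_apply] at h2
  rw [hz, map_zero, zero_add, add_comm] at h2
  exact h2

/-- Half of a filtered homotopy equivalence, as a comparison of boundary maps. -/
theorem nonempty_comparison {C D : FloerComplex.{u, v} K Γ} {Φ : C.cx ⟶ D.cx} {Ψ : D.cx ⟶ C.cx}
    (hΦ : PreservesFiltration C D Φ) (hΨ : PreservesFiltration D C Ψ)
    (h : FilteredHomotopic C C (Φ ≫ Ψ) (𝟙 C.cx)) (k : ℤ) :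
    Nonempty (Comparison (C.ℓ (k + 1)) (fun z : C.cycles k => C.ℓ k z) (C.boundary k)
      (D.ℓ (k + 1)) (fun z : D.cycles k => D.ℓ k z) (D.boundary k)) := by
  obtain ⟨-, -, H, hH⟩ := h
  exact ⟨{
    Φ := cyclesMap Φ k
    ΦV := (Φ.f (k + 1)).hom
    Ψ := cyclesMap Ψ k
    ΨV := (Ψ.f (k + 1)).hom
    H := fun z => H.hom k (k + 1) z.1
    Φ_le := fun z => hΦ k z.1
    ΦV_le := fun v => hΦ (k + 1) v
    Ψ_le := fun z => hΨ k z.1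
    ΨV_le := fun v => hΨ (k + 1) v
    H_le := fun z => hH k z.1
    Φ_map := fun v => Subtype.ext (map_d Φ (k + 1) k v).symm
    Ψ_map := fun v => Subtype.ext (map_d Ψ (k + 1) k v).symm
    Ψ_Φ := fun z => Subtype.ext (homotopy_apply_cycle H k z.1 z.2) }⟩

theorem FilteredHomotopyEquivalent.conciseBarcode_eq {C D : FloerComplex.{u, v} K Γ}
    (h : C.FilteredHomotopyEquivalent D) (k : ℤ) : C.conciseBarcode k = D.conciseBarcode k := by
  classical
  obtain ⟨Φ, Ψ, hΦ, hΨ, hC, hD⟩ := h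
  obtain ⟨M⟩ := nonempty_comparison hΦ hΨ hC k
  obtain ⟨N⟩ := nonempty_comparison hΨ hΦ hD k
  obtain ⟨s⟩ := C.nonempty_boundarySVD k
  obtain ⟨s'⟩ := D.nonempty_boundarySVD k
  rw [conciseBarcode, conciseBarcode, ← C.bars_eq_verboseBarcode s, ← D.bars_eq_verboseBarcode s']
  refine Multiset.ext.2 fun b => ?_
  rw [Multiset.count_filter, Multiset.count_filter]
  split_ifs with hb
  · refine le_antisymm ?_ ?_
    · convert M.count_le (C.filtration _) (C.cycles_filtration k) (D.filtration _)
        (D.cycles_filtration k) (C.boundary_le_level k) (D.boundary_le_level k) s s' b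
        fun h => absurd h hb.ne'
    · convert N.count_le (D.filtration _) (D.cycles_filtration k) (C.filtration _)
        (C.cycles_filtration k) (D.boundary_le_level k) (C.boundary_le_level k) s' s b
        fun h => absurd h hb.ne'
  · rfl

end FloerComplex

/-! ### Maps between cycles built from a matching of concise bars. -/

section Transfer

variable {K : Type u} [Field K] {Γ : AddSubgroup ℝ}
  {V : Type v} [AddCommGroup V] [Module (NovikovField K Γ) V]
  {W : Type v} [AddCommGroup W] [Module (NovikovField K Γ) W]
  {ℓV : V → EReal} {ℓW : W → EReal} {A : V →ₗ[NovikovField K Γ] W}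
  {V' : Type v} [AddCommGroup V'] [Module (NovikovField K Γ) V']
  {W' : Type v} [AddCommGroup W'] [Module (NovikovField K Γ) W']
  {ℓV' : V' → EReal} {ℓW' : W' → EReal} {A' : V' →ₗ[NovikovField K Γ] W'}

/-- The indices of the bars of positive length. -/
abbrev SVD.Concise (s : SVD ℓV ℓW A) : Type := {i : Fin s.m // 0 < (s.bar i).2}

theorem exists_equiv_of_map_eq {α β γ : Type*} (f : α → γ) (g : β → γ)
    (h : ∀ c, Nonempty ({a // f a = c} ≃ {b // g b = c})) :
    ∃ e : α ≃ β, ∀ a, g (e a) = f a :=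
  ⟨Equiv.ofFiberEquiv fun c => (h c).some, fun a => Equiv.ofFiberEquiv_map _ a⟩

open Classical in
theorem SVD.exists_concise_equiv (s : SVD ℓV ℓW A) (s' : SVD ℓV' ℓW' A')
    (h : s.bars.filter (fun b => 0 < b.2) = s'.bars.filter fun b => 0 < b.2) :
    ∃ e : s.Concise ≃ s'.Concise, ∀ i, s'.bar (e i).1 = s.bar i.1 := by
  refine exists_equiv_of_map_eq (fun i : s.Concise => s.bar i.1)
    (fun i : s'.Concise => s'.bar i.1) fun b => ?_
  by_cases hb : 0 < b.2
  · have h1 := congrArg (Multiset.count b) h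
    rw [Multiset.count_filter, Multiset.count_filter, if_pos hb, if_pos hb, s.count_bars,
      s'.count_bars] at h1
    exact ⟨(Equiv.subtypeSubtypeEquivSubtype (p := fun i => 0 < (s.bar i).2)
        (q := fun i => s.bar i = b) fun {i} hi => by rw [hi]; exact hb).trans
      ((Fintype.equivOfCardEq h1).trans
        (Equiv.subtypeSubtypeEquivSubtype (p := fun i => 0 < (s'.bar i).2)
          (q := fun i => s'.bar i = b) fun {i} hi => by rw [hi]; exact hb).symm)⟩
  · have e1 : IsEmpty {i : s.Concise // s.bar i.1 = b} :=
      ⟨fun i => hb (by rw [← i.2]; exact i.1.2)⟩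
    have e2 : IsEmpty {i : s'.Concise // s'.bar i.1 = b} :=
      ⟨fun i => hb (by rw [← i.2]; exact i.1.2)⟩
    exact ⟨Equiv.equivOfIsEmpty _ _⟩

open Classical in
/-- The map sending the basis vectors of the bars of positive length to rescaled basis vectors of
the corresponding bars, and the other basis vectors to zero. -/
noncomputable def SVD.transfer (s : SVD ℓV ℓW A) (s' : SVD ℓV' ℓW' A')
    (σ : s.Concise → s'.Concise) (c : s.Concise → NovikovField K Γ) :
    W →ₗ[NovikovField K Γ] W' :=
  s.x.constr (NovikovField K Γ) fun i =>
    if h : 0 < (s.bar i).2 then c ⟨i, h⟩ • s'.x (σ ⟨i, h⟩).1 else 0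

/-- `f` and `g` are filtered maps between the targets of `A` and `A'`, compatible with the singular
value decompositions, such that `g ∘ f` is the identity up to a filtered homotopy. -/
structure TransferPair (s : SVD ℓV ℓW A) (s' : SVD ℓV' ℓW' A') (f : W →ₗ[NovikovField K Γ] W')
    (g : W' →ₗ[NovikovField K Γ] W) : Prop where
  le : ∀ w, ℓW' (f w) ≤ ℓW w
  map_lift : ∀ v, A' (s'.lift (f (A v))) = f (A v)
  lift_le : ∀ v, ℓV' (s'.lift (f (A v))) ≤ ℓV v
  map_lift_sub : ∀ w, A (s.lift (w - g (f w))) = w - g (f w)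
  lift_sub_le : ∀ w, ℓV (s.lift (w - g (f w))) ≤ ℓW w

section

variable (s : SVD ℓV ℓW A) (s' : SVD ℓV' ℓW' A')

theorem SVD.transfer_x_of_pos (σ : s.Concise → s'.Concise) (c : s.Concise → NovikovField K Γ)
    (i : s.Concise) : s.transfer s' σ c (s.x i.1) = c i • s'.x (σ i).1 := by
  rw [transfer, Module.Basis.constr_basis, dif_pos i.2]

theorem SVD.transfer_x_of_not_pos (σ : s.Concise → s'.Concise) (c : s.Concise → NovikovField K Γ)
    {i : Fin s.m} (h : ¬ 0 < (s.bar i).2) : s.transfer s' σ c (s.x i) = 0 := by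
  rw [transfer, Module.Basis.constr_basis, dif_neg h]

/-- Matched bars have equal length, so scalars aligning the levels of the `x_i` also align those of
their lifts `y_i`. Since `g ∘ f` fixes the basis vectors of positive bars and kills the rest, `1 - g
f` is the projection onto zero-length bars, whose vectors are boundaries of vectors at the same
level. -/
theorem SVD.transferPair (hV : IsFiltration (K := K) (Γ := Γ) ℓV)
    (hW : IsFiltration (K := K) (Γ := Γ) ℓW)
    (hV' : IsFiltration (K := K) (Γ := Γ) ℓV') (hW' : IsFiltration (K := K) (Γ := Γ) ℓW')
    (hA : ∀ v, ℓW (A v) ≤ ℓV v) (hA' : ∀ v, ℓW' (A' v) ≤ ℓV' v)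
    (σ : s.Concise ≃ s'.Concise) (hσ : ∀ i, s'.bar (σ i).1 = s.bar i.1)
    (c : s.Concise → NovikovField K Γ) (c' : s'.Concise → NovikovField K Γ)
    (hc : ∀ i, ℓW' (c i • s'.x (σ i).1) = ℓW (s.x i.1)) (hcc : ∀ i, c i * c' (σ i) = 1) :
    TransferPair s s' (s.transfer s' σ c) (s'.transfer s σ.symm c') := by
  have hlt : ∀ i : s.Concise, (i.1 : ℕ) < s.r → ((σ i).1 : ℕ) < s'.r := by
    intro i hi
    rw [← s'.bar_snd_ne_top_iff hV' hW' hA', hσ, s.bar_snd_ne_top_iff hV hW hA]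
    exact hi
  have hlevel : ∀ i : s.Concise, (i.1 : ℕ) < s.r →
      ℓV' (c i • s'.lift (s'.x (σ i).1)) = ℓV (s.lift (s.x i.1)) := by
    intro i hi
    obtain ⟨a, ha0, ha, ha2⟩ := s.exists_length hV hW hA hi
    obtain ⟨b, hb0, hb, hb2⟩ := s'.exists_length hV' hW' hA' (hlt i hi)
    rw [hσ, ha2, ENNReal.ofReal_eq_ofReal_iff ha0 hb0] at hb2
    rw [hV'.smul_eq_add hW' hb, hc, ha, hb2]
  have hgf : ∀ i, s.x i - s'.transfer s σ.symm c' (s.transfer s' σ c (s.x i)) =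
      if 0 < (s.bar i).2 then 0 else s.x i := by
    intro i
    split_ifs with h
    · rw [s.transfer_x_of_pos s' σ c ⟨i, h⟩, map_smul, s'.transfer_x_of_pos, smul_smul, hcc,
        σ.symm_apply_apply, one_smul, sub_self]
    · rw [s.transfer_x_of_not_pos s' σ c h, map_zero, sub_zero]
  have hshort : ∀ i, ¬ 0 < (s.bar i).2 →
      (i : ℕ) < s.r ∧ ℓV (s.lift (s.x i)) = ℓW (s.x i) := by
    intro i hi
    have h0 : (s.bar i).2 = 0 := by simpa using hi
    have hr := (s.bar_snd_ne_top_iff hV hW hA).1 (by rw [h0]; exact ENNReal.zero_ne_top)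
    obtain ⟨a, ha0, ha, ha2⟩ := s.exists_length hV hW hA hr
    rw [h0, eq_comm, ENNReal.ofReal_eq_zero] at ha2
    refine ⟨hr, ?_⟩
    rw [ha, le_antisymm ha2 ha0, EReal.coe_zero, add_zero]
  have hsub : ∀ w, w - s'.transfer s σ.symm c' (s.transfer s' σ c w) =
      ∑ i, s.x.repr w i • if 0 < (s.bar i).2 then 0 else s.x i := by
    intro w
    conv_lhs => rw [← s.x.sum_repr w]
    simp only [map_sum, map_smul]
    rw [← Finset.sum_sub_distrib]
    simp only [← smul_sub, hgf]
  refine ⟨fun w => ?_, fun v => ?_, fun v => ?_, fun w => ?_, fun w => ?_⟩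
  · conv_lhs => rw [← s.x.sum_repr w, map_sum]
    refine hW'.sum_le _ _ fun i _ => ?_
    rw [map_smul]
    by_cases h : 0 < (s.bar i).2
    · rw [s.transfer_x_of_pos s' σ c ⟨i, h⟩, hW'.smul_eq_smul hW (hc ⟨i, h⟩)]
      exact s.repr_smul_le hW w i
    · rw [s.transfer_x_of_not_pos s' σ c h, smul_zero, hW'.zero]; exact bot_le
  · conv_rhs => rw [← s.x.sum_repr (A v)]
    conv_lhs => rw [← s.x.sum_repr (A v)]
    simp only [map_sum, map_smul]
    refine Finset.sum_congr rfl fun i _ => ?_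
    by_cases hi : (i : ℕ) < s.r
    · by_cases h : 0 < (s.bar i).2
      · rw [s.transfer_x_of_pos s' σ c ⟨i, h⟩, map_smul, map_smul,
          s'.map_lift_x_of_lt (hlt ⟨i, h⟩ hi)]
      · rw [s.transfer_x_of_not_pos s' σ c h, map_zero, map_zero]
    · rw [s.repr_map_of_ge v (not_lt.1 hi), zero_smul, zero_smul]
  · conv_lhs => rw [← s.x.sum_repr (A v), map_sum, map_sum]
    refine hV'.sum_le _ _ fun i _ => ?_
    rw [map_smul, map_smul]
    by_cases hi : (i : ℕ) < s.r
    · by_cases h : 0 < (s.bar i).2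
      · rw [s.transfer_x_of_pos s' σ c ⟨i, h⟩, map_smul, hV'.smul_eq_smul hV (hlevel ⟨i, h⟩ hi)]
        exact s.repr_map_smul_le hV v i
      · rw [s.transfer_x_of_not_pos s' σ c h, map_zero, smul_zero, hV'.zero]; exact bot_le
    · rw [s.repr_map_of_ge v (not_lt.1 hi), zero_smul, hV'.zero]; exact bot_le
  · rw [hsub]
    simp only [map_sum, map_smul]
    refine Finset.sum_congr rfl fun i _ => ?_
    split_ifs with h
    · simp
    · rw [s.map_lift_x_of_lt (hshort i h).1]
  · rw [hsub]
    simp only [map_sum, map_smul]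
    refine hV.sum_le _ _ fun i _ => ?_
    split_ifs with h
    · rw [map_zero, smul_zero, hV.zero]; exact bot_le
    · rw [hV.smul_eq_smul hW (hshort i h).2]
      exact s.repr_smul_le hW w i

open Classical in
theorem SVD.exists_transferPair (hV : IsFiltration (K := K) (Γ := Γ) ℓV)
    (hW : IsFiltration (K := K) (Γ := Γ) ℓW)
    (hV' : IsFiltration (K := K) (Γ := Γ) ℓV') (hW' : IsFiltration (K := K) (Γ := Γ) ℓW')
    (hA : ∀ v, ℓW (A v) ≤ ℓV v) (hA' : ∀ v, ℓW' (A' v) ≤ ℓV' v)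
    (h : s.bars.filter (fun b => 0 < b.2) = s'.bars.filter fun b => 0 < b.2) :
    ∃ (f : W →ₗ[NovikovField K Γ] W') (g : W' →ₗ[NovikovField K Γ] W),
      TransferPair s s' f g ∧ TransferPair s' s g f := by
  obtain ⟨σ, hσ⟩ := s.exists_concise_equiv s' h
  have hex : ∀ i : s.Concise, ∃ a : NovikovField K Γ, a ≠ 0 ∧
      ℓW' (a • s'.x (σ i).1) = ℓW (s.x i.1) := by
    intro i
    rw [← hW.coe_toReal (s.x.ne_zero i.1)]
    refine (s'.exists_smul_level hW').1 ?_
    rw [hσ]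
    rfl
  choose c hc0 hc using hex
  have h1 : ∀ i, c i * (c (σ.symm (σ i)))⁻¹ = 1 := fun i => by
    rw [σ.symm_apply_apply, mul_inv_cancel₀ (hc0 i)]
  refine ⟨s.transfer s' σ c, s'.transfer s σ.symm fun j => (c (σ.symm j))⁻¹, ?_, ?_⟩
  · exact s.transferPair s' hV hW hV' hW' hA hA' σ hσ c _ hc h1
  · refine s'.transferPair s hV' hW' hV hW hA' hA σ.symm (fun j => ?_) _ c (fun j => ?_) fun j => ?_
    · rw [← hσ, σ.apply_symm_apply]
    · have h2 := hW.smul_eq_smul hW' (hc (σ.symm j)).symm (c (σ.symm j))⁻¹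
      rw [h2, smul_smul, inv_mul_cancel₀ (hc0 _), one_smul, σ.apply_symm_apply]
    · exact inv_mul_cancel₀ (hc0 _)

end

end Transfer

/-! ### Extension from cycles to chains, and the round-trip homotopy. -/

namespace FloerComplex

variable {K : Type u} [Field K] {Γ : AddSubgroup ℝ} (C D : FloerComplex.{u, v} K Γ)

/-- The differential as a map into the cycles. -/
noncomputable def toCycles (i j : ℤ) : C.cx.X i →ₗ[NovikovField K Γ] C.cycles j :=
  (C.cx.d i j).hom.codRestrict (C.cycles j) fun x => C.d_d i j (j - 1) x

theorem coe_toCycles (i j : ℤ) (x : C.cx.X i) : (C.toCycles i j x : C.cx.X j) = C.cx.d i j x := rfl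

theorem toCycles_succ (k : ℤ) : C.toCycles (k + 1) k = C.boundary k := rfl

theorem toCycles_coe (i j : ℤ) (h : j + 1 = i) (z : C.cycles i) : C.toCycles i j z = 0 := by
  obtain rfl : j = i - 1 := by omega
  exact Subtype.ext z.2

theorem toCycles_d (i j k : ℤ) (x : C.cx.X i) : C.toCycles j k (C.cx.d i j x) = 0 :=
  Subtype.ext (C.d_d i j k x)

variable {C D} (s : ∀ k, C.BoundarySVD k) (s' : ∀ k, D.BoundarySVD k)

/-- The partial inverses of the boundary maps, indexed by pairs of degrees. -/
noncomputable def liftTo (i j : ℤ) : C.cycles i →ₗ[NovikovField K Γ] C.cx.X j :=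
  -- Both degrees are free, with value zero off consecutive ones, so this can serve as the component
  -- of a homotopy in all pairs of degrees.
  if h : i + 1 = j then
    Eq.rec (motive := fun j _ => C.cycles i →ₗ[NovikovField K Γ] C.cx.X j) (s i).lift h
  else 0

theorem liftTo_succ (i : ℤ) : liftTo s i (i + 1) = (s i).lift := by simp [liftTo]

theorem liftTo_eq_zero {i j : ℤ} (h : i + 1 ≠ j) : liftTo s i j = 0 := by simp [liftTo, h]

theorem toCycles_liftTo_toCycles {i j : ℤ} (h : j + 1 = i) (x : C.cx.X i) :
    C.toCycles i j (liftTo s j i (C.toCycles i j x)) = C.toCycles i j x := by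
  subst h
  rw [liftTo_succ, toCycles_succ]
  exact (s j).map_lift_map x

theorem liftTo_toCycles_liftTo {i j : ℤ} (h : j + 1 = i) (z : C.cycles j) :
    liftTo s j i (C.toCycles i j (liftTo s j i z)) = liftTo s j i z := by
  subst h
  rw [liftTo_succ, toCycles_succ]
  exact (s j).lift_map_lift z

theorem liftTo_toCycles_le {i j : ℤ} (h : j + 1 = i) (x : C.cx.X i) :
    C.ℓ i (liftTo s j i (C.toCycles i j x)) ≤ C.ℓ i x := by
  subst h
  rw [liftTo_succ, toCycles_succ]
  exact (s j).lift_map_le (C.filtration (j + 1)) x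

/-- The projection to the cycles along the span of the vectors `y_i`, `i < r`. -/
noncomputable def proj (k : ℤ) : C.cx.X k →ₗ[NovikovField K Γ] C.cycles k :=
  (LinearMap.id - liftTo s (k - 1) k ∘ₗ C.toCycles k (k - 1)).codRestrict (C.cycles k) fun x => by
    have h := congrArg Subtype.val (toCycles_liftTo_toCycles s (i := k) (j := k - 1) (by omega) x)
    rw [coe_toCycles, coe_toCycles] at h
    change C.cx.d k (k - 1) (x - liftTo s (k - 1) k (C.toCycles k (k - 1) x)) = 0
    rw [map_sub, h, sub_self]

theorem coe_proj {i j : ℤ} (h : j + 1 = i) (x : C.cx.X i) :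
    (proj s i x : C.cx.X i) = x - liftTo s j i (C.toCycles i j x) := by
  obtain rfl : j = i - 1 := by omega
  rfl

theorem proj_coe {k : ℤ} (z : C.cycles k) : proj s k z = z := by
  apply Subtype.ext
  rw [coe_proj s (j := k - 1) (by omega), C.toCycles_coe _ _ (by omega), map_zero, sub_zero]

theorem proj_d {i j : ℤ} (x : C.cx.X i) : proj s j (C.cx.d i j x) = C.toCycles i j x :=
  proj_coe s (C.toCycles i j x)

theorem proj_liftTo {i j : ℤ} (h : j + 1 = i) (z : C.cycles j) : proj s i (liftTo s j i z) = 0 := by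
  apply Subtype.ext
  rw [coe_proj s h, liftTo_toCycles_liftTo s h, sub_self]
  rfl

theorem proj_le (k : ℤ) (x : C.cx.X k) : C.ℓ k (proj s k x) ≤ C.ℓ k x := by
  rw [coe_proj s (j := k - 1) (by omega)]
  exact ((C.filtration k).sub_le _ _).trans
    (max_le le_rfl (liftTo_toCycles_le s (by omega) x))

variable {s s'} {f : ∀ k, C.cycles k →ₗ[NovikovField K Γ] D.cycles k}
  {g : ∀ k, D.cycles k →ₗ[NovikovField K Γ] C.cycles k}
  (P : ∀ k, TransferPair (s k) (s' k) (f k) (g k))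
  (Q : ∀ k, TransferPair (s' k) (s k) (g k) (f k))

include P in
theorem toCycles_liftTo_transfer {i j : ℤ} (h : j + 1 = i) (x : C.cx.X i) :
    D.toCycles i j (liftTo s' j i (f j (C.toCycles i j x))) = f j (C.toCycles i j x) := by
  subst h
  rw [liftTo_succ, toCycles_succ]
  exact (P j).map_lift x

include P in
theorem liftTo_transfer_le {i j : ℤ} (h : j + 1 = i) (x : C.cx.X i) :
    D.ℓ i (liftTo s' j i (f j (C.toCycles i j x))) ≤ C.ℓ i x := by
  subst h
  rw [liftTo_succ]
  exact (P j).lift_le x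

variable (s s' f) in
/-- The extension of maps between cycles to maps of all chains. -/
noncomputable def extendMap (k : ℤ) : C.cx.X k →ₗ[NovikovField K Γ] D.cx.X k :=
  (D.cycles k).subtype ∘ₗ f k ∘ₗ proj s k +
    liftTo s' (k - 1) k ∘ₗ f (k - 1) ∘ₗ C.toCycles k (k - 1)

theorem extendMap_apply {i j : ℤ} (h : j + 1 = i) (x : C.cx.X i) :
    extendMap s s' f i x = f i (proj s i x) + liftTo s' j i (f j (C.toCycles i j x)) := by
  obtain rfl : j = i - 1 := by omega
  rfl

include P in
theorem toCycles_extendMap {i j : ℤ} (h : j + 1 = i) (x : C.cx.X i) :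
    D.toCycles i j (extendMap s s' f i x) = f j (C.toCycles i j x) := by
  rw [extendMap_apply h, map_add, D.toCycles_coe _ _ h, toCycles_liftTo_transfer P h, zero_add]

theorem proj_extendMap {k : ℤ} (x : C.cx.X k) :
    proj s' k (extendMap s s' f k x) = f k (proj s k x) := by
  rw [extendMap_apply (j := k - 1) (by omega), map_add, proj_coe, proj_liftTo s' (by omega),
    add_zero]

include P in
theorem extendMap_le (k : ℤ) (x : C.cx.X k) : D.ℓ k (extendMap s s' f k x) ≤ C.ℓ k x := by
  rw [extendMap_apply (j := k - 1) (by omega)]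
  exact ((D.filtration k).add_le _ _).trans (max_le (((P k).le _).trans (proj_le s k x))
    (liftTo_transfer_le P (by omega) x))

/-- The chain map given by `extendMap`. -/
noncomputable def extendChainMap : C.cx ⟶ D.cx where
  f k := ModuleCat.ofHom (extendMap s s' f k)
  comm' i j hij := by
    have h : j + 1 = i := by simpa using hij
    refine ModuleCat.hom_ext (LinearMap.ext fun x => ?_)
    change D.cx.d i j (extendMap s s' f i x) = extendMap s s' f j (C.cx.d i j x)
    -- A boundary is fixed by `proj`, and the second summand of `extendMap` vanishes on it because
    -- the differential squares to zero.
    rw [← coe_toCycles, toCycles_extendMap P h, extendMap_apply (j := j - 1) (by omega), proj_d,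
      toCycles_d, map_zero, map_zero, add_zero]

theorem extendChainMap_preserves : PreservesFiltration C D (extendChainMap P) :=
  fun k x => extendMap_le P k x

variable (s f g) in
/-- The homotopy between a round trip and the identity. -/
noncomputable def roundTripHom (i j : ℤ) : C.cx.X i →ₗ[NovikovField K Γ] C.cx.X j :=
  -(liftTo s i j ∘ₗ (LinearMap.id - g i ∘ₗ f i) ∘ₗ proj s i)

theorem roundTripHom_apply (i j : ℤ) (x : C.cx.X i) : roundTripHom s f g i j x =
    -(liftTo s i j (proj s i x - g i (f i (proj s i x)))) := rfl

include P in
theorem d_roundTripHom (k : ℤ) (x : C.cx.X k) : C.cx.d (k + 1) k (roundTripHom s f g k (k + 1) x) =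
    -((proj s k x : C.cx.X k) - g k (f k (proj s k x))) := by
  rw [roundTripHom_apply, map_neg, liftTo_succ]
  exact congrArg (fun z : C.cycles k => -(z : C.cx.X k)) ((P k).map_lift_sub (proj s k x))

include P in
-- The identity of the chains is `proj + lift ∘ ∂`, while the round trip inserts `g f` in both
-- summands. The two defects are the two terms of the homotopy formula: on cycles `1 - g f` is
-- undone by lifting and taking the boundary, and on the complement it is evaluated on `∂ x`.
theorem extendMap_extendMap (k : ℤ) (x : C.cx.X k) :
    extendMap s' s g k (extendMap s s' f k x) =
      roundTripHom s f g (k - 1) k (C.cx.d k (k - 1) x) +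
        C.cx.d (k + 1) k (roundTripHom s f g k (k + 1) x) + x := by
  have hk : k - 1 + 1 = k := by omega
  have hx : (proj s k x : C.cx.X k) = x - liftTo s (k - 1) k (C.toCycles k (k - 1) x) :=
    coe_proj s hk x
  rw [extendMap_apply hk, proj_extendMap, toCycles_extendMap P hk, d_roundTripHom P,
    roundTripHom_apply, proj_d, map_sub, hx]
  abel

/-- The round trip is homotopic to the identity. -/
noncomputable def roundTripHomotopy :
    Homotopy (extendChainMap P ≫ extendChainMap Q) (𝟙 C.cx) where
  hom i j := ModuleCat.ofHom (roundTripHom s f g i j)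
  zero i j hij := by
    have h : i + 1 ≠ j := by simpa using hij
    refine ModuleCat.hom_ext (LinearMap.ext fun x => ?_)
    rw [ModuleCat.hom_ofHom, roundTripHom_apply, liftTo_eq_zero s h, LinearMap.zero_apply, neg_zero]
    rfl
  comm k := by
    rw [dNext_eq _ (show (ComplexShape.down ℤ).Rel k (k - 1) by simp),
      prevD_eq _ (show (ComplexShape.down ℤ).Rel (k + 1) k by simp)]
    refine ModuleCat.hom_ext (LinearMap.ext fun x => ?_)
    rw [ModuleCat.hom_add, ModuleCat.hom_add, ModuleCat.hom_comp, ModuleCat.hom_comp,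
      HomologicalComplex.comp_f, ModuleCat.hom_comp, HomologicalComplex.id_f, ModuleCat.hom_id]
    exact extendMap_extendMap P k x

theorem filteredHomotopic_roundTrip :
    FilteredHomotopic C C (extendChainMap P ≫ extendChainMap Q) (𝟙 C.cx) := by
  refine ⟨fun k x => ?_, fun k x => le_rfl, roundTripHomotopy P Q, fun k x => ?_⟩
  · exact (extendMap_le Q k _).trans (extendMap_le P k x)
  · change C.ℓ (k + 1) (roundTripHom s f g k (k + 1) x) ≤ C.ℓ k x
    rw [roundTripHom_apply, (C.filtration _).neg, liftTo_succ]
    exact ((P k).lift_sub_le _).trans (proj_le s k x)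

theorem filteredHomotopyEquivalent_of_conciseBarcode_eq
    (h : ∀ k : ℤ, C.conciseBarcode k = D.conciseBarcode k) : C.FilteredHomotopyEquivalent D := by
  let s := fun k => Classical.choice (C.nonempty_boundarySVD k)
  let s' := fun k => Classical.choice (D.nonempty_boundarySVD k)
  have hex := fun k => (s k).exists_transferPair (s' k) (C.filtration _) (C.cycles_filtration k)
    (D.filtration _) (D.cycles_filtration k) (C.boundary_le_level k) (D.boundary_le_level k) (by
      have := h k
      rwa [conciseBarcode, conciseBarcode, ← C.bars_eq_verboseBarcode (s k),
        ← D.bars_eq_verboseBarcode (s' k)] at this)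
  choose f g P Q using hex
  exact ⟨extendChainMap P, extendChainMap Q, extendChainMap_preserves P,
    extendChainMap_preserves Q, filteredHomotopic_roundTrip P Q, filteredHomotopic_roundTrip Q P⟩

end FloerComplex

end FloerType

theorem theoremB {K : Type u} [Field K] {Γ : AddSubgroup ℝ}
    (C D : FloerType.FloerComplex.{u, v} K Γ) :
    (C.BarcodesWellDefined ∧ D.BarcodesWellDefined) ∧
      (C.FilteredHomotopyEquivalent D ↔
        ∀ k : ℤ, C.conciseBarcode k = D.conciseBarcode k) :=
  ⟨⟨C.barcodesWellDefined, D.barcodesWellDefined⟩,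
    fun h => h.conciseBarcode_eq,
    FloerType.FloerComplex.filteredHomotopyEquivalent_of_conciseBarcode_eq⟩
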